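/- **Setting.** $\mathcal S(\mathbb R^n)$ is the Schwartz space and $\mathcal S'(\mathbb R^n)$ its strong dual. Write $T_xf(t)=f(t-x)$, $M_\xi f(t)=e^{2\pi i\xi\cdot t}f(t)$ and $\pi(x,\xi)=M_\xi T_x$. A Banach space $E$ is a *translation-modulation invariant Banach space of distributions* (TMIB) on $\mathbb R^n$ if there are dense continuous inclusions $\mathcal S(\mathbb R^n)\hookrightarrow E\hookrightarrow\mathcal S'(\mathbb R^n)$, if $T_x(E)\subseteq E$ and $M_\xi(E)\subseteq E$ for all $x,\xi\in\mathbb R^n$, and if there are $\tau_0,\tau_1,C_0,C_1>0$ such that $\|T_x\|_{\mathcal L(E)}\le C_0(1+|x|)^{\tau_0}$ and $\|M_\xi\|_{\mathcal L(E)}\le C_1(1+|\xi|)^{\tau_1}$ for all $x,\xi$. A *DTMIB* is the strong dual of a TMIB, regarded as a subspace of $\mathcal S'(\mathbb R^n)$ by restricting functionals to $\mathcal S(\mathbb R^n)$. For a TMIB or DTMIB $E$ let $\mathcal D_E=\{f\in\mathcal S'(\mathbb R^n) : f^{(\alpha)}\in E\ \ \forall\alpha\in\mathbb N^n\}$, with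 the topology generated by the norms $\|f\|_{E,N}=\sup_{|\alpha|\le N}\|f^{(\alpha)}\|_E$, $N\in\mathbb N$. Let $\Lambda_0,\Lambda_1$ be lattices in $\mathbb R^n$ (discrete subgroups that span $\mathbb R^n$) and $\Lambda=\Lambda_0\times\Lambda_1$. Let $U$ be a bounded open neighbourhood of $0$ such that the sets $\lambda+U$, $\lambda\in\Lambda_0$, are pairwise disjoint, and let $\chi\neq0$ be a smooth function with compact support contained in $U$. Let $$E_d(\Lambda_0)=\Big\{c\in\mathbb C^{\Lambda_0} : S_\chi(c):=\sum_{\lambda\in\Lambda_0}c_\lambda T_\lambda\chi\in E\Big\},\qquad \|c\|_{E_d(\Lambda_0)}=\|S_\chi(c)\|_E,$$ where the locally finite series is taken in the sense of distributions. Let $s(\Lambda_1;E_d(\Lambda_0))$ be the space of all families $c=(c_{\lambda_1})_{\lambda_1\in\Lambda_1}$ in $E_d(\Lambda_0)$ with $\sup_{\lambda_1\in\Lambda_1}\|c_{\lambda_1}\|_{E_d(\Lambda_0)}(1+|\lambda_1|)^N<\infty$ for all $N\in\mathbb N$, with the topology generated by these norms. Its elements are written $c=(c_{\lambda_0,\lambda_1})_{(\lambda_0,\lambda_1)\in\Lambda}$.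 For $\psi\in\mathcal S(\mathbb R^n)$ and $f\in\mathcal S'(\mathbb R^n)$ let $V_\psi f(x,\xi)=\langle f,\pi(x,-\xi)\overline\psi\rangle$ be the short-time Fourier transform. **Proposition.** Let $E$ be a TMIB or DTMIB on $\mathbb R^n$, let $\Lambda_0,\Lambda_1,U,\chi$ be as above, and let $\psi\in\mathcal S(\mathbb R^n)$. Then: 1. The analysis operator $$C_\psi:\mathcal D_E\to s(\Lambda_1;E_d(\Lambda_0)),\qquad f\mapsto\big(V_\psi f(\lambda_0,\lambda_1)\big)_{(\lambda_0,\lambda_1)\in\Lambda},$$ is a well-defined continuous linear map. 2. The synthesis operator $$D_\psi:s(\Lambda_1;E_d(\Lambda_0))\to\mathcal D_E,\qquad c\mapsto\sum_{(\lambda_0,\lambda_1)\in\Lambda}c_{\lambda_0,\lambda_1}\,\pi(\lambda_0,\lambda_1)\psi,$$ is a well-defined continuous linear map: the series converges unconditionally in $\mathcal S'(\mathbb R^n)$, its sum belongs to $\mathcal D_E$ and depends continuously on $c$. -/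

import Mathlib

open Filter Topology MeasureTheory
open scoped SchwartzMap ContDiff LineDeriv

noncomputable section

namespace Gabor

/-! ### Schwartz functions and tempered distributions on `ℝⁿ` -/

/-- `ℝⁿ` with its Euclidean norm. -/
abbrev V (n : ℕ) : Type := EuclideanSpace ℝ (Fin n)

/-- The Schwartz space `𝓢(ℝⁿ)`. -/
abbrev Test (n : ℕ) : Type := 𝓢(V n, ℂ)

/-- The space of tempered distributions: the strong dual of the Schwartz space, with the topology
of uniform convergence on bounded sets. -/
abbrev Dist (n : ℕ) : Type := StrongDual ℂ (Test n)

variable {n : ℕ}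

/-- The character `t ↦ e^{2πi ξ·t}`. -/
def character (ξ t : V n) : ℂ := Complex.exp (2 * Real.pi * Complex.I * (inner ℝ ξ t : ℝ))

lemma hasTemperateGrowth_character (ξ : V n) : (character ξ).HasTemperateGrowth := by
  have hd : ∀ (t : ℝ), HasDerivAt (fun s : ℝ => Complex.exp (2 * Real.pi * Complex.I * (s : ℂ)))
      (2 * Real.pi * Complex.I * Complex.exp (2 * Real.pi * Complex.I * (t : ℂ))) t := by
    intro t
    have h1 : HasDerivAt (fun s : ℝ => 2 * Real.pi * Complex.I * (s : ℂ))
        (2 * Real.pi * Complex.I * 1) t := (Complex.ofRealCLM.hasDerivAt (x := t)).const_mul _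
    have h2 := h1.cexp
    rwa [mul_one, mul_comm (Complex.exp _)] at h2
  have hit : ∀ k : ℕ,
      iteratedDeriv k (fun s : ℝ => Complex.exp (2 * Real.pi * Complex.I * (s : ℂ))) =
      fun s : ℝ => (2 * Real.pi * Complex.I) ^ k *
        Complex.exp (2 * Real.pi * Complex.I * (s : ℂ)) := by
    intro k
    induction k with
    | zero => simp
    | succ k ih =>
      rw [iteratedDeriv_succ, ih]
      funext s
      rw [((hd s).const_mul _).deriv]
      ring
  have hg : (fun s : ℝ => Complex.exp (2 * Real.pi * Complex.I * (s : ℂ))).HasTemperateGrowth := by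
    refine ⟨?_, fun k => ⟨0, (2 * Real.pi) ^ k, fun x => ?_⟩⟩
    · exact Complex.contDiff_exp.comp (contDiff_const.mul Complex.ofRealCLM.contDiff)
    · rw [norm_iteratedFDeriv_eq_norm_iteratedDeriv, hit k]
      have : 2 * Real.pi * Complex.I * (x : ℂ) = ((2 * Real.pi * x : ℝ) : ℂ) * Complex.I := by
        push_cast; ring
      rw [norm_mul, this, Complex.norm_exp_ofReal_mul_I]
      simp [abs_of_pos Real.pi_pos]
  exact hg.comp (innerSL ℝ ξ).hasTemperateGrowth

/-- Translation `T_x φ (t) = φ (t - x)` of Schwartz functions. -/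
def translateTest (x : V n) : Test n →L[ℂ] Test n := SchwartzMap.compSubConstCLM ℂ x

/-- Modulation `M_ξ φ (t) = e^{2πi ξ·t} φ (t)` of Schwartz functions. -/
def modulateTest (ξ : V n) : Test n →L[ℂ] Test n := SchwartzMap.smulLeftCLM ℂ (character ξ)

lemma translateTest_apply (x : V n) (φ : Test n) (t : V n) :
    translateTest x φ t = φ (t - x) := rfl

lemma modulateTest_apply (ξ : V n) (φ : Test n) (t : V n) :
    modulateTest ξ φ t = character ξ t * φ t := by
  simp [modulateTest, SchwartzMap.smulLeftCLM_apply_apply (hasTemperateGrowth_character ξ)]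

/-- The time-frequency shift `π(x, ξ) = M_ξ T_x`. -/
def timeFreqShift (x ξ : V n) (φ : Test n) : Test n := modulateTest ξ (translateTest x φ)

/-- The complex conjugate of a Schwartz function. -/
def conjTest (φ : Test n) : Test n :=
  SchwartzMap.postcompCLM (𝕜 := ℝ) (Complex.conjCLE : ℂ →L[ℝ] ℂ) φ

lemma conjTest_apply (φ : Test n) (t : V n) :
    conjTest φ t = (starRingEnd ℂ) (φ t) := rfl

/-- The canonical embedding of Schwartz functions into tempered distributions. -/
def ofTest (φ : Test n) : Dist n :=
  (SchwartzMap.integralCLM ℂ (volume : Measure (V n))) ∘L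
    (SchwartzMap.pairing (ContinuousLinearMap.mul ℂ ℂ) φ)

lemma ofTest_apply (φ θ : Test n) : ofTest φ θ = ∫ t, φ t * θ t := rfl

/-- Translation of tempered distributions: `⟨T_x f, φ⟩ = ⟨f, T_{-x} φ⟩`. -/
def translate (x : V n) (f : Dist n) : Dist n := f ∘L translateTest (-x)

/-- Modulation of tempered distributions: `⟨M_ξ f, φ⟩ = ⟨f, M_ξ φ⟩`. -/
def modulate (ξ : V n) (f : Dist n) : Dist n := f ∘L modulateTest ξ

/-- The partial derivative `∂_i` of tempered distributions: `⟨∂_i f, φ⟩ = -⟨f, ∂_i φ⟩`. -/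
def partialDeriv (i : Fin n) : Module.End ℂ (Dist n) where
  toFun f := -(f ∘L LineDeriv.lineDerivOpCLM ℂ (Test n) (EuclideanSpace.single i (1 : ℝ)))
  map_add' f g := by ext φ; simp; ring
  map_smul' c f := by ext φ; simp

/-- The derivative `f^{(α)} = ∂_1^{α_1} ⋯ ∂_n^{α_n} f` for a multi-index `α`. -/
def multiDeriv (α : Fin n → ℕ) : Module.End ℂ (Dist n) :=
  (List.ofFn fun i => partialDeriv i ^ α i).prod

lemma exists_cutoff (n : ℕ) : ∃ η : Test n, HasCompactSupport η ∧ ∀ x : V n, ‖x‖ ≤ 1 → η x = 1 := by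
  let b : ContDiffBump (0 : V n) := ⟨1, 2, one_pos, one_lt_two⟩
  have hbs : HasCompactSupport (fun x => (b x : ℂ)) :=
    b.hasCompactSupport.comp_left (g := ((↑) : ℝ → ℂ)) Complex.ofReal_zero
  have hbd : ContDiff ℝ ∞ (fun x => (b x : ℂ)) := Complex.ofRealCLM.contDiff.comp b.contDiff
  refine ⟨hbs.toSchwartzMap hbd, hbs, fun x hx => ?_⟩
  have : b x = 1 := b.one_of_mem_closedBall (by simpa [b] using hx)
  change (b x : ℂ) = 1
  rw [this, Complex.ofReal_one]

/-- Test functions with compact support are dense in the Schwartz space. -/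
lemma dist_eq_zero (T : Dist n) (h : ∀ φ : Test n, HasCompactSupport φ → T φ = 0) : T = 0 := by
  ext φ
  obtain ⟨η, hbs, hη⟩ := exists_cutoff n
  let c : ℕ → ℝ := fun N => ((N : ℝ) + 1)⁻¹
  have hc0 : ∀ N, 0 < c N := fun N => by positivity
  have hc1 : ∀ N, c N ≤ 1 := fun N => inv_le_one_of_one_le₀ (by simp)
  have hsd : ∀ N, ContDiff ℝ ∞ (fun x : V n => η (c N • x)) := fun N =>
    (η.smooth ⊤).comp (contDiff_const_smul _)
  have hss : ∀ N, HasCompactSupport (fun x : V n => η (c N • x)) := fun N =>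
    hbs.comp_homeomorph (Homeomorph.smulOfNeZero (c N) (hc0 N).ne')
  have hpd : ∀ N, ContDiff ℝ ∞ (fun x : V n => η (c N • x) * φ x) := fun N =>
    (hsd N).mul (φ.smooth ⊤)
  obtain ⟨Φ, hΦ⟩ : ∃ Φ : ℕ → Test n, ∀ N, (Φ N : V n → ℂ) = fun x => η (c N • x) * φ x :=
    ⟨fun N => ((hss N).mul_right (f' := φ)).toSchwartzMap (hpd N), fun N => rfl⟩
  have hT0 : ∀ N, T (Φ N) = 0 := fun N => h _ (by rw [hΦ]; exact (hss N).mul_right (f' := φ))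
  have hlim : Tendsto Φ atTop (𝓝 φ) := by
    rw [(schwartz_withSeminorms ℂ (V n) ℂ).tendsto_nhds]
    rintro ⟨k, m⟩ ε hε
    let K : ℝ := ∑ i ∈ Finset.range (m + 1), (m.choose i : ℝ) *
      SchwartzMap.seminorm ℂ 0 i η * SchwartzMap.seminorm ℂ (k + 1) (m - i) φ
    let K' : ℝ := K + SchwartzMap.seminorm ℂ (k + 1) m φ
    have hK : 0 ≤ K := Finset.sum_nonneg fun i _ => by positivity
    have hK' : 0 ≤ K' := by positivity
    have hbound : ∀ N, SchwartzMap.seminorm ℂ k m (Φ N - φ) ≤ c N * K' := by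
      intro N
      refine SchwartzMap.seminorm_le_bound ℂ k m _ (by have := hc0 N; positivity) fun x => ?_
      have hcoe : ((Φ N - φ : Test n) : V n → ℂ) = (fun x => η (c N • x) * φ x) - φ := by
        rw [← hΦ]; rfl
      by_cases hx : ‖c N • x‖ < 1
      · have hev : ((Φ N - φ : Test n) : V n → ℂ) =ᶠ[𝓝 x] (fun _ => (0 : ℂ)) := by
          have : ∀ᶠ y in 𝓝 x, ‖c N • y‖ < 1 :=
            (continuous_const_smul (c N)).norm.continuousAt.eventually_lt_const hx
          filter_upwards [this] with y hy
          rw [hcoe]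
          simp [hη _ hy.le]
        rw [(Filter.EventuallyEq.iteratedFDeriv (𝕜 := ℝ) hev m).self_of_nhds]
        have := hc0 N
        simp only [iteratedFDeriv_fun_zero, Pi.zero_apply, norm_zero, mul_zero]
        positivity
      · push Not at hx
        rw [norm_smul, Real.norm_of_nonneg (hc0 N).le] at hx
        have h1 : ‖iteratedFDeriv ℝ m (fun x => η (c N • x) * φ x) x‖ ≤
            ∑ i ∈ Finset.range (m + 1), (m.choose i : ℝ) *
              SchwartzMap.seminorm ℂ 0 i η * ‖iteratedFDeriv ℝ (m - i) φ x‖ := by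
          refine (norm_iteratedFDeriv_mul_le (hsd N) (φ.smooth ⊤) x (n := m)
            (by exact_mod_cast le_top)).trans (Finset.sum_le_sum fun i _ => ?_)
          gcongr
          have hcomp := iteratedFDeriv_comp_const_smul (𝕜 := ℝ) (i := i) (c N)
            ((η.smooth i))
          rw [congrFun hcomp x, norm_smul]
          have h2 := SchwartzMap.le_seminorm ℂ 0 i η (c N • x)
          rw [pow_zero, one_mul] at h2
          have h3 : ‖c N ^ i‖ ≤ 1 := by
            rw [norm_pow, Real.norm_of_nonneg (hc0 N).le]
            exact pow_le_one₀ (hc0 N).le (hc1 N)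
          calc _ ≤ 1 * SchwartzMap.seminorm ℂ 0 i η := by gcongr
            _ = _ := one_mul _
        have h4 : ‖x‖ ^ (k + 1) * ‖iteratedFDeriv ℝ m (Φ N - φ : Test n) x‖ ≤ K' := by
          rw [hcoe, iteratedFDeriv_sub_apply
            ((hpd N).of_le (by exact_mod_cast le_top)).contDiffAt (φ.smooth m).contDiffAt]
          calc _ ≤ ‖x‖ ^ (k + 1) * ((∑ i ∈ Finset.range (m + 1), (m.choose i : ℝ) *
                SchwartzMap.seminorm ℂ 0 i η * ‖iteratedFDeriv ℝ (m - i) φ x‖)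
                + ‖iteratedFDeriv ℝ m φ x‖) := by
                  gcongr
                  exact (norm_sub_le _ _).trans (by gcongr)
            _ ≤ K' := by
              rw [mul_add, Finset.mul_sum]
              refine add_le_add (Finset.sum_le_sum fun i _ => ?_)
                (SchwartzMap.le_seminorm ℂ (k + 1) m φ x)
              have h5 := SchwartzMap.le_seminorm ℂ (k + 1) (m - i) φ x
              calc _ = (m.choose i : ℝ) * SchwartzMap.seminorm ℂ 0 i η *
                    (‖x‖ ^ (k + 1) * ‖iteratedFDeriv ℝ (m - i) φ x‖) := by ring
                _ ≤ _ := by gcongr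
        calc _ ≤ (c N * ‖x‖) * (‖x‖ ^ k * ‖iteratedFDeriv ℝ m (Φ N - φ : Test n) x‖) :=
              le_mul_of_one_le_left (by positivity) hx
          _ = c N * (‖x‖ ^ (k + 1) * ‖iteratedFDeriv ℝ m (Φ N - φ : Test n) x‖) := by ring
          _ ≤ _ := mul_le_mul_of_nonneg_left h4 (hc0 N).le
    have hcl : Tendsto (fun N => c N * K') atTop (𝓝 0) := by
      have : Tendsto c atTop (𝓝 0) := by
        simpa [c, one_div] using tendsto_one_div_add_atTop_nhds_zero_nat (𝕜 := ℝ)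
      simpa using this.mul_const K'
    filter_upwards [hcl.eventually_lt_const hε] with N hN
    exact (hbound N).trans_lt hN
  have h1 : Tendsto (fun N => T (Φ N)) atTop (𝓝 (T φ)) := (T.continuous.tendsto φ).comp hlim
  simp only [hT0] at h1
  exact (tendsto_nhds_unique h1 tendsto_const_nhds)

/-! ### Translation-modulation invariant Banach spaces of distributions -/

/-- A normed space `E` of tempered distributions on `ℝⁿ`: a continuous injective linear map
`E → 𝓢'(ℝⁿ)`, by which `E` is regarded as a subspace of `𝓢'(ℝⁿ)`. -/
structure DistSpace (n : ℕ) (E : Type*) [NormedAddCommGroup E] [NormedSpace ℂ E] where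
  incl : E →L[ℂ] Dist n
  injective_incl : Function.Injective incl

section DistSpace

variable {E : Type*} [NormedAddCommGroup E] [NormedSpace ℂ E]

/-- The inverse of the inclusion `E → 𝓢'(ℝⁿ)` on its range. -/
def DistSpace.lift (X : DistSpace n E) : LinearMap.range X.incl.toLinearMap ≃ₗ[ℂ] E :=
  (LinearEquiv.ofInjective X.incl.toLinearMap X.injective_incl).symm

lemma DistSpace.incl_lift (X : DistSpace n E) (f : LinearMap.range X.incl.toLinearMap) :
    X.incl (X.lift f) = f :=
  congrArg Subtype.val
    ((LinearEquiv.ofInjective X.incl.toLinearMap X.injective_incl).apply_symm_apply f)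

/-- The Banach space `E` is a translation-modulation invariant Banach space of distributions. In
`translate_bound` and `modulate_bound` the vector `e'` is the element `T_x e`, resp. `M_ξ e`, of
`E`, so that these say `‖T_x‖ ≤ C₀ (1 + |x|)^τ₀` and `‖M_ξ‖ ≤ C₁ (1 + |ξ|)^τ₁`. -/
structure IsTMIB [CompleteSpace E] (X : DistSpace n E) : Prop where
  dense_incl : ∃ j : Test n →L[ℂ] E, DenseRange j ∧ ∀ φ, X.incl (j φ) = ofTest φ
  translate_mem : ∀ (x : V n) (e : E), ∃ e' : E, X.incl e' = translate x (X.incl e)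
  modulate_mem : ∀ (ξ : V n) (e : E), ∃ e' : E, X.incl e' = modulate ξ (X.incl e)
  translate_bound : ∃ τ₀ C₀ : ℝ, 0 < τ₀ ∧ 0 < C₀ ∧ ∀ (x : V n) (e e' : E),
    X.incl e' = translate x (X.incl e) → ‖e'‖ ≤ C₀ * (1 + ‖x‖) ^ τ₀ * ‖e‖
  modulate_bound : ∃ τ₁ C₁ : ℝ, 0 < τ₁ ∧ 0 < C₁ ∧ ∀ (ξ : V n) (e e' : E),
    X.incl e' = modulate ξ (X.incl e) → ‖e'‖ ≤ C₁ * (1 + ‖ξ‖) ^ τ₁ * ‖e‖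

/-- `E` is the strong dual of a TMIB `F`; a functional on `F` is regarded as a tempered distribution
by restriction to `𝓢(ℝⁿ) ⊆ F`. -/
def IsDTMIB.{u} {E : Type u} [NormedAddCommGroup E] [NormedSpace ℂ E] (X : DistSpace n E) : Prop :=
  ∃ (F : Type u) (_ : NormedAddCommGroup F) (_ : NormedSpace ℂ F) (_ : CompleteSpace F)
    (Y : DistSpace n F), IsTMIB Y ∧
    ∃ Φ : E ≃ₗᵢ[ℂ] StrongDual ℂ F,
      ∀ (e : E) (φ : Test n) (u : F), Y.incl u = ofTest φ → X.incl e φ = Φ e u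

/-! ### The test function space `𝓓_E` -/

/-- `𝓓_E` as a subspace of `𝓢'(ℝⁿ)`: all derivatives belong to `E`. -/
def testSubmodule (X : DistSpace n E) : Submodule ℂ (Dist n) :=
  ⨅ α : Fin n → ℕ, (LinearMap.range X.incl.toLinearMap).comap (multiDeriv α)

lemma mem_testSubmodule (X : DistSpace n E) (f : Dist n) :
    f ∈ testSubmodule X ↔ ∀ α : Fin n → ℕ, ∃ e : E, X.incl e = multiDeriv α f := by
  simp [testSubmodule, Submodule.mem_iInf]

/-- The space `𝓓_E`. It is a type of its own because it does not carry the topology of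
`𝓢'(ℝⁿ)`. -/
def TestSpace (X : DistSpace n E) : Type := testSubmodule X

instance (X : DistSpace n E) : AddCommGroup (TestSpace X) :=
  inferInstanceAs (AddCommGroup (testSubmodule X))

instance (X : DistSpace n E) : Module ℂ (TestSpace X) :=
  inferInstanceAs (Module ℂ (testSubmodule X))

/-- The inclusion of `𝓓_E` into `𝓢'(ℝⁿ)`. -/
def TestSpace.toDist (X : DistSpace n E) : TestSpace X →ₗ[ℂ] Dist n := (testSubmodule X).subtype

/-- `f ↦ f^{(α)}` as a map from `𝓓_E` to `E`. -/
def TestSpace.deriv (X : DistSpace n E) (α : Fin n → ℕ) : TestSpace X →ₗ[ℂ] E :=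
  X.lift.toLinearMap ∘ₗ ((multiDeriv α ∘ₗ (testSubmodule X).subtype).codRestrict _
    fun f => (Submodule.mem_iInf _).1 f.2 α)

lemma TestSpace.incl_deriv (X : DistSpace n E) (α : Fin n → ℕ) (f : TestSpace X) :
    X.incl (TestSpace.deriv X α f) = multiDeriv α (TestSpace.toDist X f) :=
  X.incl_lift _

/-- The multi-indices `α` with `|α| ≤ N`. -/
def multiIndices (n N : ℕ) : Finset (Fin n → ℕ) :=
  (Fintype.piFinset fun _ => Finset.range (N + 1)).filter fun α => ∑ i, α i ≤ N

lemma mem_multiIndices (N : ℕ) (α : Fin n → ℕ) : α ∈ multiIndices n N ↔ ∑ i, α i ≤ N := by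
  simp only [multiIndices, Finset.mem_filter, Fintype.mem_piFinset, Finset.mem_range,
    and_iff_right_iff_imp]
  intro h i
  exact Nat.lt_succ_of_le ((Finset.single_le_sum (f := α) (fun _ _ => Nat.zero_le _)
    (Finset.mem_univ i)).trans h)

/-- The norms `‖f‖_{E,N} = sup_{|α| ≤ N} ‖f^{(α)}‖_E`. -/
def TestSpace.seminorms (X : DistSpace n E) : SeminormFamily ℂ (TestSpace X) ℕ := fun N =>
  (multiIndices n N).sup fun α => (normSeminorm ℂ E).comp (TestSpace.deriv X α)

/-- The locally convex topology of `𝓓_E`, generated by the norms `‖·‖_{E,N}`. -/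
instance (X : DistSpace n E) : TopologicalSpace (TestSpace X) :=
  (TestSpace.seminorms X).moduleFilterBasis.topology

/-! ### The discrete space `E_d(Λ)` -/

/-- `S_χ(c) = ∑_λ c_λ T_λ χ` is the element `e` of `E`. Here `χ` has compact support, and the
series, which is locally finite for every `c`, is summed in the sense of distributions, that is,
against test functions of compact support. -/
def IsSynth (X : DistSpace n E) {Λ : Submodule ℤ (V n)} (χ : Test n) (c : Λ → ℂ) (e : E) : Prop :=
  ∀ φ : Test n, HasCompactSupport φ →
    HasSum (fun l : Λ => c l * ofTest (translateTest (l : V n) χ) φ) (X.incl e φ)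

lemma IsSynth.unique {X : DistSpace n E} {Λ : Submodule ℤ (V n)} {χ : Test n} {c : Λ → ℂ}
    {e e' : E} (h : IsSynth X χ c e) (h' : IsSynth X χ c e') : e = e' := by
  refine X.injective_incl (sub_eq_zero.1 (dist_eq_zero _ fun φ hφ => ?_))
  simp [(h φ hφ).unique (h' φ hφ)]

/-- `E_d(Λ)` as a subspace of `ℂ^Λ`: all `c` such that `S_χ(c)` belongs to `E`. -/
def discreteSubmodule (X : DistSpace n E) (Λ : Submodule ℤ (V n)) (χ : Test n) :
    Submodule ℂ (Λ → ℂ) where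
  carrier := {c | ∃ e : E, IsSynth X χ c e}
  add_mem' := by
    rintro c c' ⟨e, h⟩ ⟨e', h'⟩
    exact ⟨e + e', fun φ hφ => by simpa [add_mul] using (h φ hφ).add (h' φ hφ)⟩
  zero_mem' := ⟨0, fun φ hφ => by simp⟩
  smul_mem' := by
    rintro a c ⟨e, h⟩
    exact ⟨a • e, fun φ hφ => by simpa [mul_assoc] using (h φ hφ).mul_left a⟩

/-- The space `E_d(Λ) = E_{d,χ}(Λ)`. -/
def DiscreteSpace (X : DistSpace n E) (Λ : Submodule ℤ (V n)) (χ : Test n) : Type :=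
  discreteSubmodule X Λ χ

section Discrete

variable (X : DistSpace n E) (Λ : Submodule ℤ (V n)) (χ : Test n)

instance : AddCommGroup (DiscreteSpace X Λ χ) :=
  inferInstanceAs (AddCommGroup (discreteSubmodule X Λ χ))

instance : Module ℂ (DiscreteSpace X Λ χ) :=
  inferInstanceAs (Module ℂ (discreteSubmodule X Λ χ))

/-- The coefficients `(c_λ)` of an element of `E_d(Λ)`. -/
def DiscreteSpace.coeff : DiscreteSpace X Λ χ →ₗ[ℂ] (Λ → ℂ) := (discreteSubmodule X Λ χ).subtype

/-- The map `c ↦ S_χ(c)` from `E_d(Λ)` to `E`. -/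
def DiscreteSpace.synth : DiscreteSpace X Λ χ →ₗ[ℂ] E where
  toFun c := c.2.choose
  map_add' c c' := (c + c').2.choose_spec.unique fun φ hφ => by
    have h := (c.2.choose_spec φ hφ).add (c'.2.choose_spec φ hφ)
    simp only [← add_mul] at h
    rw [map_add]
    exact h
  map_smul' a c := (a • c).2.choose_spec.unique fun φ hφ => by
    have h := (c.2.choose_spec φ hφ).mul_left a
    simp only [← mul_assoc] at h
    rw [map_smul]
    exact h

lemma DiscreteSpace.isSynth (c : DiscreteSpace X Λ χ) :
    IsSynth X χ (DiscreteSpace.coeff X Λ χ c) (DiscreteSpace.synth X Λ χ c) :=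
  c.2.choose_spec

/-- The norm `‖c‖ = ‖S_χ(c)‖_E`. -/
instance : SeminormedAddCommGroup (DiscreteSpace X Λ χ) :=
  SeminormedAddCommGroup.induced _ E (DiscreteSpace.synth X Λ χ)

lemma DiscreteSpace.norm_def (c : DiscreteSpace X Λ χ) : ‖c‖ = ‖DiscreteSpace.synth X Λ χ c‖ := rfl

instance : NormedSpace ℂ (DiscreteSpace X Λ χ) :=
  NormedSpace.induced ℂ _ E (DiscreteSpace.synth X Λ χ)

end Discrete

end DistSpace

/-! ### Rapidly decreasing vector-valued sequences -/

section Rapid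

variable (Λ : Submodule ℤ (V n)) (B : Type*) [SeminormedAddCommGroup B] [NormedSpace ℂ B]

/-- The families in `B^Λ` which belong to `ℓ^∞_{(1+|·|)^N}(Λ; B)` for every `N`. -/
def rapidSubmodule : Submodule ℂ (Λ → B) where
  carrier := {x | ∀ N : ℕ, BddAbove (Set.range fun l : Λ => ‖x l‖ * (1 + ‖(l : V n)‖) ^ N)}
  add_mem' := by
    intro x y hx hy N
    obtain ⟨a, ha⟩ := hx N
    obtain ⟨b, hb⟩ := hy N
    refine ⟨a + b, ?_⟩
    rintro _ ⟨l, rfl⟩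
    have h1 := ha ⟨l, rfl⟩
    have h2 := hb ⟨l, rfl⟩
    calc ‖x l + y l‖ * (1 + ‖(l : V n)‖) ^ N
        ≤ (‖x l‖ + ‖y l‖) * (1 + ‖(l : V n)‖) ^ N := by gcongr; exact norm_add_le _ _
      _ ≤ a + b := by rw [add_mul]; exact add_le_add h1 h2
  zero_mem' N := ⟨0, by rintro _ ⟨l, rfl⟩; simp⟩
  smul_mem' := by
    intro a x hx N
    obtain ⟨b, hb⟩ := hx N
    refine ⟨‖a‖ * b, ?_⟩
    rintro _ ⟨l, rfl⟩
    have h1 := hb ⟨l, rfl⟩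
    simp only [Pi.smul_apply, norm_smul, mul_assoc]
    exact mul_le_mul_of_nonneg_left h1 (norm_nonneg a)

/-- The space `s(Λ; B)`. -/
def RapidSpace : Type _ := rapidSubmodule Λ B

instance : AddCommGroup (RapidSpace Λ B) := inferInstanceAs (AddCommGroup (rapidSubmodule Λ B))

instance : Module ℂ (RapidSpace Λ B) := inferInstanceAs (Module ℂ (rapidSubmodule Λ B))

/-- The entries `(x_λ)` of an element of `s(Λ; B)`. -/
def RapidSpace.coeff : RapidSpace Λ B →ₗ[ℂ] (Λ → B) := (rapidSubmodule Λ B).subtype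

/-- The norms `‖x‖_N = sup_λ ‖x_λ‖ (1 + |λ|)^N` of `ℓ^∞_{(1+|·|)^N}(Λ; B)`. -/
def RapidSpace.seminorms : SeminormFamily ℂ (RapidSpace Λ B) ℕ := fun N =>
  Seminorm.of (fun x => ⨆ l : Λ, ‖RapidSpace.coeff Λ B x l‖ * (1 + ‖(l : V n)‖) ^ N)
    (fun x y => by
      refine ciSup_le fun l => ?_
      calc ‖RapidSpace.coeff Λ B (x + y) l‖ * (1 + ‖(l : V n)‖) ^ N
          ≤ (‖RapidSpace.coeff Λ B x l‖ + ‖RapidSpace.coeff Λ B y l‖) * (1 + ‖(l : V n)‖) ^ N := by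
            gcongr
            rw [map_add]
            exact norm_add_le _ _
        _ ≤ _ := by
            rw [add_mul]
            exact add_le_add (le_ciSup (x.2 N) l) (le_ciSup (y.2 N) l))
    (fun a x => by
      rw [Real.mul_iSup_of_nonneg (norm_nonneg a)]
      refine iSup_congr fun l => ?_
      rw [map_smul, Pi.smul_apply, norm_smul, mul_assoc])

/-- The topology of the projective limit `s(Λ; B)`, generated by the norms `‖·‖_N`. -/
instance : TopologicalSpace (RapidSpace Λ B) :=
  (RapidSpace.seminorms Λ B).moduleFilterBasis.topology

end Rapid

/-! ### Short-time Fourier transform -/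

/-- The short-time Fourier transform `V_ψ f(x, ξ) = ⟨f, π(x, -ξ) \bar ψ⟩`. -/
def stft (ψ : Test n) (f : Dist n) (x ξ : V n) : ℂ := f (timeFreqShift x (-ξ) (conjTest ψ))

end Gabor

end

/-! Both operators are controlled by two properties of `E`: translations and modulations act on `E`
with polynomially bounded norms (`ShiftBounded`), and for all Schwartz `φ`, `ψ` the operator
`A_{φ,ψ} e = ∑_λ ⟨e, T_λ φ⟩ T_λ ψ` over `Λ₀` is bounded on `E` (`FrameBounded`).

The second property is the heart of the matter. The kernel of `A_{φ,ψ}` is `∑_λ ψ(t-λ) φ(s-λ)`.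
Writing `s = t - x` turns it into the periodization at `t` of `h_x = ψ · T_x φ`, and Poisson
summation (`exists_poisson`) expands this into characters with frequencies `k_m` and coefficients
`a_m(h_x)`, which decay rapidly both in `k_m` and in `x`. Hence `A_{φ,ψ} = ∑_m ∫ a_m(h_x) M_{k_m}
T_x dx`, and the polynomial bounds make this superposition converge absolutely
(`ShiftBounded.exists_frameOp_test`). On a TMIB this is done for Schwartz functions and extended by
density (`IsTMIB.exists_frameOp`); on a dual, `A_{φ,ψ}` is the transpose of `A_{ψ,φ}`
(`IsDTMIB.frameBounded`).

Analysis: for fixed `ξ` the sequence `V_ψ f(·, ξ)` is synthesized by `χ` to `A_{ψ̄,χ}(M_{-ξ} f)`, so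
its norm grows at most polynomially in `ξ`. Integration by parts trades each factor `ξ_i` for a
derivative on the window or on `f`; as all derivatives of `f` lie in `E`, rapid decay follows
(`exists_analysis_bound`).

Synthesis: the translates of `χ` have disjoint supports, so pairing `S_χ(c)` with `T_λ χ̄` gives
`c_λ ‖χ‖₂²`. Thus `∑_λ c_λ T_λ ψ = ‖χ‖₂⁻² A_{χ̄,ψ}(S_χ(c))` lies in `E` with norm at most a constant
times `‖c‖`. Modulating by `λ₁` costs a polynomial factor, and summing over `λ₁` is paid for by
rapid decay (`exists_gaborSum`). A derivative of a Gabor series is the sum of two Gabor series, one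
with coefficients multiplied by `2πi λ_{1,i}` and one with window `∂_i ψ`, so induction on the order
puts all derivatives in `E`. -/

noncomputable section

namespace Gabor

variable {n : ℕ}

/-! ### Products and translations of Schwartz functions -/

/-- The pointwise product of Schwartz functions. -/
def mulTest (η : Test n) : Test n →L[ℂ] Test n :=
  SchwartzMap.pairing (ContinuousLinearMap.mul ℂ ℂ) η

@[simp] lemma mulTest_apply (η ψ : Test n) (t : V n) : mulTest η ψ t = η t * ψ t := rfl

/-- Submultiplicativity of the weight: joint decay in `t` and `t - x` becomes decay in `x`. -/
lemma one_add_norm_le_mul (t x : V n) : 1 + ‖x‖ ≤ (1 + ‖t‖) * (1 + ‖t - x‖) := by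
  have h : ‖x‖ ≤ ‖t‖ + ‖t - x‖ := by
    have := norm_sub_le t (t - x)
    rwa [sub_sub_cancel] at this
  nlinarith [norm_nonneg t, norm_nonneg (t - x), mul_nonneg (norm_nonneg t) (norm_nonneg (t - x))]

lemma iteratedFDeriv_translateTest (x : V n) (φ : Test n) (m : ℕ) (t : V n) :
    iteratedFDeriv ℝ m (translateTest x φ) t = iteratedFDeriv ℝ m φ (t - x) := by
  have : (translateTest x φ : V n → ℂ) = fun t => φ (t - x) := rfl
  rw [this, iteratedFDeriv_comp_sub]

/-- The Schwartz norms controlling derivatives up to order `m` with weight `(1 + |t|)^k`. -/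
def schwartzNorm (n k m : ℕ) : Seminorm ℂ (Test n) :=
  (Finset.Iic (k, m)).sup (schwartzSeminormFamily ℂ (V n) ℂ)

lemma continuous_schwartzNorm (k m : ℕ) : Continuous (schwartzNorm n k m) :=
  Seminorm.continuous_finsetSup fun i _ =>
    (schwartz_withSeminorms ℂ (V n) ℂ).continuous_seminorm i

lemma schwartzNorm_mono {k k' m m' : ℕ} (hk : k ≤ k') (hm : m ≤ m') (φ : Test n) :
    schwartzNorm n k m φ ≤ schwartzNorm n k' m' φ :=
  Seminorm.le_def.1 (Finset.sup_mono (Finset.Iic_subset_Iic.2 (Prod.mk_le_mk.2 ⟨hk, hm⟩))) φ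

lemma one_add_pow_mul_le_schwartzNorm {k m i : ℕ} (hi : i ≤ m) (φ : Test n) (t : V n) :
    (1 + ‖t‖) ^ k * ‖iteratedFDeriv ℝ i φ t‖ ≤ 2 ^ k * schwartzNorm n k m φ :=
  SchwartzMap.one_add_le_sup_seminorm_apply (𝕜 := ℂ) (m := (k, m)) le_rfl hi φ t

/-- Leibniz rule, with the weight in `x` split between the two factors; the weight in `t` is given
to `η`. -/
lemma exists_seminorm_mulTest_translateTest_le (k m N : ℕ) : ∃ C : ℝ, 0 ≤ C ∧
    ∀ (η ψ : Test n) (x : V n), (1 + ‖x‖) ^ N *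
      SchwartzMap.seminorm ℂ k m (mulTest η (translateTest x ψ)) ≤
        C * schwartzNorm n (N + k) m η * schwartzNorm n (N + k) m ψ := by
  refine ⟨∑ i ∈ Finset.range (m + 1), (m.choose i : ℝ) * (2 ^ (N + k) * 2 ^ (N + k)),
    by positivity, fun η ψ x => ?_⟩
  have hx : 0 < (1 + ‖x‖) ^ N := by positivity
  rw [← le_div_iff₀' hx]
  refine SchwartzMap.seminorm_le_bound ℂ k m _ (by positivity) fun t => ?_
  rw [le_div_iff₀' hx]
  have hl := norm_iteratedFDeriv_mul_le (η.smooth ⊤) ((translateTest x ψ).smooth ⊤) t (n := m)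
    (by exact_mod_cast le_top)
  have hcoe : (mulTest η (translateTest x ψ) : V n → ℂ) = fun t => η t * translateTest x ψ t := rfl
  rw [hcoe]
  calc (1 + ‖x‖) ^ N * (‖t‖ ^ k * ‖iteratedFDeriv ℝ m (fun t => η t * translateTest x ψ t) t‖)
      ≤ ((1 + ‖t‖) * (1 + ‖t - x‖)) ^ N * ((1 + ‖t‖) ^ k *
        ∑ i ∈ Finset.range (m + 1), (m.choose i : ℝ) * ‖iteratedFDeriv ℝ i η t‖ *
          ‖iteratedFDeriv ℝ (m - i) (translateTest x ψ) t‖) := by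
        gcongr
        · exact one_add_norm_le_mul t x
        · linarith
    _ ≤ ∑ i ∈ Finset.range (m + 1), (m.choose i : ℝ) * (2 ^ (N + k) * 2 ^ (N + k)) *
          schwartzNorm n (N + k) m η * schwartzNorm n (N + k) m ψ := by
        rw [Finset.mul_sum, Finset.mul_sum]
        refine Finset.sum_le_sum fun i hi => ?_
        have h1 := one_add_pow_mul_le_schwartzNorm (k := N + k)
          (Nat.lt_succ_iff.1 (Finset.mem_range.1 hi)) η t
        have h2 := one_add_pow_mul_le_schwartzNorm (k := N + k) (Nat.sub_le m i) ψ (t - x)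
        rw [iteratedFDeriv_translateTest]
        have h3 : (1 + ‖t - x‖) ^ N ≤ (1 + ‖t - x‖) ^ (N + k) :=
          pow_le_pow_right₀ (by linarith [norm_nonneg (t - x)]) (Nat.le_add_right _ _)
        calc _ = (m.choose i : ℝ) * (((1 + ‖t‖) ^ (N + k) * ‖iteratedFDeriv ℝ i η t‖) *
              ((1 + ‖t - x‖) ^ N * ‖iteratedFDeriv ℝ (m - i) ψ (t - x)‖)) := by
              rw [mul_pow, pow_add]; ring
          _ ≤ (m.choose i : ℝ) * ((2 ^ (N + k) * schwartzNorm n (N + k) m η) *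
              (2 ^ (N + k) * schwartzNorm n (N + k) m ψ)) := by
              have h4 := (mul_le_mul_of_nonneg_right h3
                (norm_nonneg (iteratedFDeriv ℝ (m - i) ψ (t - x)))).trans h2
              refine mul_le_mul_of_nonneg_left ?_ (by positivity)
              exact mul_le_mul h1 h4 (by positivity) (by positivity)
          _ = _ := by ring
    _ = _ := by rw [Finset.sum_mul, Finset.sum_mul]

/-- Products `η · T_x ψ` decay rapidly in `x`, in every continuous seminorm. -/
lemma exists_mulTest_translateTest_le {q : Seminorm ℂ (Test n)} (hq : Continuous q) (N : ℕ) :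
    ∃ p : Seminorm ℂ (Test n), Continuous p ∧ ∀ (η ψ : Test n) (x : V n),
      (1 + ‖x‖) ^ N * q (mulTest η (translateTest x ψ)) ≤ p η * p ψ := by
  obtain ⟨s, C, -, hC⟩ := Seminorm.bound_of_continuous (schwartz_withSeminorms ℂ (V n) ℂ) q hq
  choose B hB0 hB using fun i : ℕ × ℕ => exists_seminorm_mulTest_translateTest_le (n := n) i.1 i.2 N
  obtain ⟨M, hM⟩ : ∃ M : ℕ, ∀ i ∈ s, i.1 ≤ M ∧ i.2 ≤ M :=
    ⟨s.sup fun i => max i.1 i.2, fun i hi =>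
      max_le_iff.1 (Finset.le_sup (f := fun i : ℕ × ℕ => max i.1 i.2) hi)⟩
  lift B to ℕ × ℕ → NNReal using hB0
  -- The same seminorm has to serve both factors, so its constant gets squared; the summand `1`
  -- ensures `K - 1 ≤ K²`.
  let K : NNReal := 1 + C * ∑ i ∈ s, B i
  refine ⟨K • schwartzNorm n (N + M) M, (continuous_schwartzNorm _ _).const_smul K,
    fun η ψ x => ?_⟩
  have hK : (K : ℝ) = 1 + C * ∑ i ∈ s, (B i : ℝ) := by
    simp only [K, NNReal.coe_add, NNReal.coe_one, NNReal.coe_mul, NNReal.coe_sum]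
  have h1 : q (mulTest η (translateTest x ψ)) ≤
      C * ∑ i ∈ s, SchwartzMap.seminorm ℂ i.1 i.2 (mulTest η (translateTest x ψ)) := by
    refine (hC _).trans ?_
    rw [smul_apply, NNReal.smul_def, smul_eq_mul]
    gcongr
    refine (Seminorm.le_def.1 (Seminorm.finset_sup_le_sum _ s) _).trans_eq ?_
    rw [sum_apply]
    rfl
  set a := schwartzNorm n (N + M) M η
  set b := schwartzNorm n (N + M) M ψ
  have ha : 0 ≤ a := apply_nonneg _ _
  have hb : 0 ≤ b := apply_nonneg _ _
  calc (1 + ‖x‖) ^ N * q (mulTest η (translateTest x ψ))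
      ≤ (1 + ‖x‖) ^ N * (C * ∑ i ∈ s,
          SchwartzMap.seminorm ℂ i.1 i.2 (mulTest η (translateTest x ψ))) := by gcongr
    _ = C * ∑ i ∈ s, (1 + ‖x‖) ^ N *
          SchwartzMap.seminorm ℂ i.1 i.2 (mulTest η (translateTest x ψ)) := by
        rw [Finset.mul_sum, Finset.mul_sum, Finset.mul_sum]
        exact Finset.sum_congr rfl fun i _ => by ring
    _ ≤ C * ∑ i ∈ s, B i * a * b := by
        refine mul_le_mul_of_nonneg_left (Finset.sum_le_sum fun i hi => ?_) C.2
        refine (hB i η ψ x).trans ?_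
        gcongr
        · exact schwartzNorm_mono (by have := (hM i hi).1; omega) (hM i hi).2 η
        · exact schwartzNorm_mono (by have := (hM i hi).1; omega) (hM i hi).2 ψ
    _ = (C * ∑ i ∈ s, (B i : ℝ)) * (a * b) := by
        simp only [mul_assoc, Finset.sum_mul]
    _ ≤ (K * K) * (a * b) := by
        refine mul_le_mul_of_nonneg_right ?_ (by positivity)
        rw [hK]
        have : 0 ≤ (C : ℝ) * ∑ i ∈ s, (B i : ℝ) := by positivity
        nlinarith
    _ = (K • schwartzNorm n (N + M) M) η * (K • schwartzNorm n (N + M) M) ψ := by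
        simp only [smul_apply, NNReal.smul_def, smul_eq_mul]
        ring

lemma exists_norm_mulTest_translateTest_le {G : Type*} [NormedAddCommGroup G] [NormedSpace ℂ G]
    (T : Test n →L[ℂ] G) (N : ℕ) :
    ∃ p : Seminorm ℂ (Test n), Continuous p ∧ ∀ (η ψ : Test n) (x : V n),
      (1 + ‖x‖) ^ N * ‖T (mulTest η (translateTest x ψ))‖ ≤ p η * p ψ :=
  exists_mulTest_translateTest_le (q := (normSeminorm ℂ G).comp T.toLinearMap)
    (continuous_norm.comp T.continuous) N

lemma translateTest_translateTest (x y : V n) (φ : Test n) :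
    translateTest x (translateTest y φ) = translateTest (x + y) φ := by
  ext t; simp [translateTest_apply, sub_sub]

/-- Mean value inequality on the segment from `t` to `t - x`. It has length at most `1`, so the
weights at its points are comparable to that at `t` up to the factor `2`. -/
lemma exists_seminorm_translateTest_sub_le (k m : ℕ) (φ : Test n) : ∃ C : ℝ,
    ∀ x : V n, ‖x‖ ≤ 1 → SchwartzMap.seminorm ℂ k m (translateTest x φ - φ) ≤ C * ‖x‖ := by
  refine ⟨2 ^ k * (2 ^ k * schwartzNorm n k (m + 1) φ), fun x hx => ?_⟩
  refine SchwartzMap.seminorm_le_bound ℂ k m _ (by positivity) fun t => ?_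
  have hcoe : ((translateTest x φ - φ : Test n) : V n → ℂ) = translateTest x φ - φ := rfl
  rw [hcoe, iteratedFDeriv_sub_apply ((translateTest x φ).smooth m).contDiffAt
    (φ.smooth m).contDiffAt, iteratedFDeriv_translateTest]
  have ht : 0 < (1 + ‖t‖) ^ k := by positivity
  have hd : ∀ s ∈ segment ℝ t (t - x), ‖fderiv ℝ (iteratedFDeriv ℝ m φ) s‖ ≤
      2 ^ k * (2 ^ k * schwartzNorm n k (m + 1) φ) / (1 + ‖t‖) ^ k := by
    intro s hs
    rw [norm_fderiv_iteratedFDeriv, le_div_iff₀' ht]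
    have h1 : ‖s - t‖ ≤ 1 := by
      refine (norm_sub_le_of_mem_segment hs).trans ?_
      simpa using hx
    have h2 : 1 + ‖t‖ ≤ 2 * (1 + ‖s‖) := by
      have := norm_sub_norm_le t s
      rw [norm_sub_rev] at this
      linarith [norm_nonneg s]
    calc _ ≤ (2 * (1 + ‖s‖)) ^ k * ‖iteratedFDeriv ℝ (m + 1) φ s‖ := by gcongr
      _ = 2 ^ k * ((1 + ‖s‖) ^ k * ‖iteratedFDeriv ℝ (m + 1) φ s‖) := by rw [mul_pow]; ring
      _ ≤ _ := by
        exact mul_le_mul_of_nonneg_left (one_add_pow_mul_le_schwartzNorm le_rfl φ s)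
          (by positivity)
  have hdiff : ∀ s ∈ segment ℝ t (t - x), DifferentiableAt ℝ (iteratedFDeriv ℝ m φ) s :=
    fun s _ => ((φ.smooth ⊤).differentiable_iteratedFDeriv
      (by exact_mod_cast WithTop.coe_lt_top m)).differentiableAt
  have h := (convex_segment (𝕜 := ℝ) t (t - x)).norm_image_sub_le_of_norm_fderiv_le hdiff hd
    (left_mem_segment ℝ _ _) (right_mem_segment ℝ _ _)
  rw [sub_sub_cancel_left, norm_neg, div_mul_eq_mul_div, le_div_iff₀' ht] at h
  refine le_trans ?_ h
  gcongr
  linarith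

/-- Makes the vector-valued integrand of the frame operator continuous in `x`, hence measurable.
Continuity at `0` is carried to other points by the group law. -/
lemma continuous_translateTest (φ : Test n) : Continuous fun x : V n => translateTest x φ := by
  have h0 : Tendsto (fun x : V n => translateTest x φ) (𝓝 0) (𝓝 φ) := by
    rw [(schwartz_withSeminorms ℂ (V n) ℂ).tendsto_nhds]
    rintro ⟨k, m⟩ ε hε
    obtain ⟨C, hC⟩ := exists_seminorm_translateTest_sub_le k m φ
    have h1 : Tendsto (fun x : V n => C * ‖x‖) (𝓝 0) (𝓝 0) := by
      have : Continuous fun x : V n => C * ‖x‖ := by fun_prop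
      simpa using this.tendsto 0
    have h2 : ∀ᶠ x : V n in 𝓝 0, ‖x‖ < 1 :=
      (continuous_norm.tendsto (0 : V n)).eventually_lt_const (by simp)
    filter_upwards [h1.eventually_lt_const hε, h2] with x hx hx'
    exact (hC x hx'.le).trans_lt hx
  refine continuous_iff_continuousAt.2 fun x₀ => ?_
  have h1 : Tendsto (fun x : V n => x - x₀) (𝓝 x₀) (𝓝 0) := by
    have : Continuous fun x : V n => x - x₀ := by fun_prop
    simpa using this.tendsto x₀
  have h2 := ((translateTest x₀).continuous.tendsto φ).comp (h0.comp h1)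
  refine h2.congr fun x => ?_
  simp [translateTest_translateTest]

/-! ### Summability over lattices -/

lemma summable_one_add_norm_pow_inv (Λ : Submodule ℤ (V n)) [DiscreteTopology Λ] [IsZLattice ℝ Λ]
    {N : ℕ} (hN : n < N) : Summable fun l : Λ => ((1 + ‖(l : V n)‖) ^ N)⁻¹ := by
  have hr : Module.finrank ℤ Λ = n := by
    rw [ZLattice.rank ℝ Λ, finrank_euclideanSpace_fin]
  -- The comparison with `‖l‖⁻¹ ^ N` fails only at `l = 0`, where the convention `0⁻¹ = 0` makes the
  -- right side vanish.
  refine Summable.of_norm_bounded_eventually (ZLattice.summable_norm_pow_inv Λ N (hr.trans_lt hN))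
    ((Set.finite_singleton 0).subset fun l hl => ?_)
  by_contra hne
  refine hl ?_
  have h1 : 0 < ‖(l : V n)‖ := norm_pos_iff.2 fun h => hne (Subtype.ext h)
  change ‖((1 + ‖(l : V n)‖) ^ N)⁻¹‖ ≤ ‖(l : V n)‖⁻¹ ^ N
  rw [Real.norm_of_nonneg (by positivity), inv_pow]
  gcongr
  linarith

/-! ### Poisson summation -/

/-- Integer vectors as points of `ℝⁿ`. -/
def intPoint : (Fin n → ℤ) →+ V n where
  toFun m := WithLp.toLp 2 fun i => (m i : ℝ)
  map_zero' := by ext i; simp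
  map_add' a b := by ext i; simp

lemma intPoint_apply (m : Fin n → ℤ) (i : Fin n) : intPoint m i = m i := rfl

/-- The integer lattice in `ℝⁿ`, parametrised by its coordinates. -/
def intLatticeEquiv (n : ℕ) : Submodule.span ℤ (Set.range (EuclideanSpace.basisFun (Fin n) ℝ).toBasis)
    ≃ₗ[ℤ] (Fin n → ℤ) :=
  ((EuclideanSpace.basisFun (Fin n) ℝ).toBasis.restrictScalars ℤ).equivFun

lemma intPoint_eq_sum (m : Fin n → ℤ) :
    intPoint m = ∑ i, m i • (EuclideanSpace.basisFun (Fin n) ℝ).toBasis i := by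
  ext j
  simp [intPoint_apply, Pi.single_apply]

lemma coe_intLatticeEquiv_symm (m : Fin n → ℤ) :
    (((intLatticeEquiv n).symm m : _) : V n) = intPoint m := by
  rw [intLatticeEquiv, Module.Basis.equivFun_symm_apply, intPoint_eq_sum,
    ← Submodule.subtype_apply, map_sum]
  refine Finset.sum_congr rfl fun i _ => ?_
  rw [map_smul, Submodule.subtype_apply, Module.Basis.restrictScalars_apply]

lemma summable_intPoint {N : ℕ} (hN : n < N) :
    Summable fun m : Fin n → ℤ => ((1 + ‖intPoint m‖) ^ N)⁻¹ := by
  have h := summable_one_add_norm_pow_inv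
    (Submodule.span ℤ (Set.range (EuclideanSpace.basisFun (Fin n) ℝ).toBasis)) hN
  rw [← (intLatticeEquiv n).symm.toEquiv.summable_iff] at h
  exact h.congr fun m => by rw [← coe_intLatticeEquiv_symm m]; rfl

/-- A majorant of the translates that is locally uniform in `t`; with `N = n + 1` it is summable
over integer points. -/
lemma norm_apply_add_le (h : Test n) (N : ℕ) (t x : V n) :
    ‖h (t + x)‖ ≤ (1 + ‖t‖) ^ N * (2 ^ N * schwartzNorm n N 0 h) * ((1 + ‖x‖) ^ N)⁻¹ := by
  rw [← div_eq_mul_inv, le_div_iff₀ (by positivity)]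
  have h1 := one_add_pow_mul_le_schwartzNorm (k := N) le_rfl h (t + x) (m := 0)
  rw [norm_iteratedFDeriv_zero] at h1
  have h2 : 1 + ‖x‖ ≤ (1 + ‖t‖) * (1 + ‖t + x‖) := by
    have := one_add_norm_le_mul (-t) x
    rwa [norm_neg, ← norm_neg (-t - x), neg_sub, sub_neg_eq_add, add_comm x t] at this
  calc ‖h (t + x)‖ * (1 + ‖x‖) ^ N ≤ ‖h (t + x)‖ * ((1 + ‖t‖) * (1 + ‖t + x‖)) ^ N := by gcongr
    _ = (1 + ‖t‖) ^ N * ((1 + ‖t + x‖) ^ N * ‖h (t + x)‖) := by rw [mul_pow]; ring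
    _ ≤ _ := by gcongr

lemma summable_norm_apply_add_intPoint (h : Test n) (t : V n) :
    Summable fun m : Fin n → ℤ => ‖h (t + intPoint m)‖ :=
  Summable.of_nonneg_of_le (fun _ => norm_nonneg _) (fun _ => norm_apply_add_le h (n + 1) t _)
    ((summable_intPoint (Nat.lt_succ_self n)).mul_left _)

lemma continuous_periodization (h : Test n) :
    Continuous fun t : V n => ∑' m : Fin n → ℤ, h (t + intPoint m) := by
  refine continuous_iff_continuousAt.2 fun t₀ => ?_
  have hc : ContinuousOn (fun t : V n => ∑' m : Fin n → ℤ, h (t + intPoint m))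
      (Metric.ball 0 (‖t₀‖ + 1)) := by
    refine continuousOn_tsum (fun _ => (h.continuous.comp (continuous_add_const _)).continuousOn)
      ((summable_intPoint (Nat.lt_succ_self n)).mul_left
        ((1 + (‖t₀‖ + 1)) ^ (n + 1) * (2 ^ (n + 1) * schwartzNorm n (n + 1) 0 h))) fun _ t ht => ?_
    refine (norm_apply_add_le h (n + 1) t _).trans ?_
    have : ‖t‖ ≤ ‖t₀‖ + 1 := by simpa using (Metric.mem_ball.1 ht).le
    gcongr
  exact hc.continuousAt (Metric.isOpen_ball.mem_nhds (by simp))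

/-- The projection of `ℝⁿ` onto the torus. -/
def torusMk (n : ℕ) : C(Fin n → ℝ, UnitAddTorus (Fin n)) where
  toFun s i := (s i : UnitAddCircle)
  continuous_toFun := by
    refine continuous_pi fun i => ?_
    exact (AddCircle.continuous_mk' 1).comp (continuous_apply i)

lemma isQuotientMap_torusMk : IsQuotientMap (torusMk n) :=
  (IsOpenQuotientMap.piMap fun _ : Fin n => QuotientAddGroup.isOpenQuotientMap_mk).isQuotientMap

lemma exists_int_of_torusMk_eq {s s' : Fin n → ℝ} (h : torusMk n s = torusMk n s') :
    ∃ m : Fin n → ℤ, s = s' + fun i => (m i : ℝ) := by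
  have : ∀ i, ∃ m : ℤ, s i = s' i + m := fun i => by
    have hi := congrFun h i
    change (s i : UnitAddCircle) = (s' i : UnitAddCircle) at hi
    rw [← sub_eq_zero, ← AddCircle.coe_sub, AddCircle.coe_eq_zero_iff] at hi
    obtain ⟨m, hm⟩ := hi
    exact ⟨m, by simp at hm; linarith⟩
  choose m hm using this
  exact ⟨m, funext hm⟩

lemma periodization_add_intPoint (h : Test n) (t : V n) (z : Fin n → ℤ) :
    ∑' m : Fin n → ℤ, h (t + intPoint z + intPoint m) = ∑' m : Fin n → ℤ, h (t + intPoint m) := by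
  rw [← (Equiv.addLeft z).tsum_eq (fun m : Fin n → ℤ => h (t + intPoint m))]
  simp [add_assoc]

/-- The sum of all integer translates of a Schwartz function, as a function on the torus. -/
def torusPeriodization (h : Test n) : C(UnitAddTorus (Fin n), ℂ) :=
  isQuotientMap_torusMk.lift
    ⟨fun s : Fin n → ℝ => ∑' m : Fin n → ℤ, h (WithLp.toLp 2 s + intPoint m),
      (continuous_periodization h).comp (PiLp.continuous_toLp 2 _)⟩ (by
    intro s s' hs
    obtain ⟨z, rfl⟩ := exists_int_of_torusMk_eq hs
    exact periodization_add_intPoint h (WithLp.toLp 2 s') z)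

lemma torusPeriodization_torusMk (h : Test n) (s : Fin n → ℝ) :
    torusPeriodization h (torusMk n s) = ∑' m : Fin n → ℤ, h (WithLp.toLp 2 s + intPoint m) := by
  exact DFunLike.congr_fun (f := (torusPeriodization h).comp (torusMk n))
    (IsQuotientMap.lift_comp isQuotientMap_torusMk _ _) s

lemma mFourier_torusMk (m : Fin n → ℤ) (s : Fin n → ℝ) :
    UnitAddTorus.mFourier m (torusMk n s) = character (intPoint m) (WithLp.toLp 2 s) := by
  have : UnitAddTorus.mFourier m (torusMk n s) = ∏ i, fourier (m i) (s i : UnitAddCircle) := rfl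
  rw [this, character]
  simp_rw [fourier_coe_apply]
  rw [← Complex.exp_sum]
  congr 1
  rw [PiLp.inner_apply]
  push_cast
  rw [Finset.mul_sum]
  refine Finset.sum_congr rfl fun i _ => ?_
  simp [intPoint_apply]
  ring

lemma norm_character (ξ t : V n) : ‖character ξ t‖ = 1 := by
  have : 2 * Real.pi * Complex.I * ((inner ℝ ξ t : ℝ) : ℂ) =
      ((2 * Real.pi * inner ℝ ξ t : ℝ) : ℂ) * Complex.I := by push_cast; ring
  rw [character, this, Complex.norm_exp_ofReal_mul_I]

lemma character_add_right (ξ s t : V n) : character ξ (s + t) = character ξ s * character ξ t := by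
  rw [character, character, character, ← Complex.exp_add, inner_add_right]
  push_cast
  ring_nf

lemma continuous_character (ξ : V n) : Continuous (character ξ) := by
  unfold character
  fun_prop

lemma character_intPoint (m z : Fin n → ℤ) : character (intPoint m) (intPoint z) = 1 := by
  rw [character, Complex.exp_eq_one_iff]
  refine ⟨∑ i, m i * z i, ?_⟩
  rw [PiLp.inner_apply]
  simp [intPoint_apply]
  rw [mul_comm]
  congr 1
  exact Finset.sum_congr rfl fun i _ => mul_comm _ _

/-- The torus integral uses left-open cubes and the lattice fundamental domain right-open ones; they
differ by a null set. -/
lemma integral_cube_eq_fundamentalDomain (g : (Fin n → ℝ) → ℂ) :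
    ∫ s in {s : Fin n → ℝ | ∀ i, s i ∈ Set.Ioc ((0 : Fin n → ℝ) i) ((0 : Fin n → ℝ) i + 1)}, g s =
      ∫ t in ZSpan.fundamentalDomain (EuclideanSpace.basisFun (Fin n) ℝ).toBasis,
        g (WithLp.ofLp t) := by
  have h1 : {s : Fin n → ℝ | ∀ i, s i ∈ Set.Ioc ((0 : Fin n → ℝ) i) ((0 : Fin n → ℝ) i + 1)} =
      Set.univ.pi fun i => Set.Ioc ((0 : Fin n → ℝ) i) ((1 : Fin n → ℝ) i) := by
    ext s; simp
  have h2 : (Set.univ.pi fun i => Set.Ioc ((0 : Fin n → ℝ) i) ((1 : Fin n → ℝ) i)) =ᵐ[volume]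
      Set.univ.pi fun i => Set.Ico ((0 : Fin n → ℝ) i) ((1 : Fin n → ℝ) i) :=
    Measure.univ_pi_Ioc_ae_eq_Icc.trans Measure.univ_pi_Ico_ae_eq_Icc.symm
  rw [h1, setIntegral_congr_set h2]
  have h3 := (EuclideanSpace.volume_preserving_symm_measurableEquiv_toLp (Fin n)).setIntegral_preimage_emb
    (MeasurableEquiv.measurableEmbedding _) g
    (Set.univ.pi fun i => Set.Ico ((0 : Fin n → ℝ) i) ((1 : Fin n → ℝ) i))
  rw [← h3]
  congr 2
  ext t
  simp [ZSpan.fundamentalDomain]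

lemma fourier_apply_eq (h : Test n) (ξ : V n) :
    FourierTransform.fourier h ξ = ∫ t, character (-ξ) t * h t := by
  rw [SchwartzMap.fourier_coe, Real.fourier_eq']
  refine integral_congr_ae (.of_forall fun t => ?_)
  simp only [character, smul_eq_mul]
  congr 2
  rw [inner_neg_left, real_inner_comm]
  push_cast
  ring

lemma integrable_character_mul (ξ : V n) (h : Test n) :
    Integrable fun t => character ξ t * h t := by
  have := (modulateTest ξ h).integrable (μ := volume)
  exact this.congr (.of_forall fun t => modulateTest_apply ξ h t)

/-- Unfolding: the integral over `ℝⁿ` splits over the integer translates of the unit cube, and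
characters of integer frequency do not see these translations. -/
lemma mFourierCoeff_torusPeriodization (h : Test n) (m : Fin n → ℤ) :
    UnitAddTorus.mFourierCoeff (torusPeriodization h) m = FourierTransform.fourier h (intPoint m) := by
  rw [UnitAddTorus.mFourierCoeff_eq_integral _ _ 0, fourier_apply_eq]
  set D := ZSpan.fundamentalDomain (EuclideanSpace.basisFun (Fin n) ℝ).toBasis
  set k : V n → ℂ := fun t => character (-intPoint m) t * h t
  have hk : Integrable k := integrable_character_mul _ h
  have hbd : ∀ t ∈ D, ‖t‖ ≤ Finset.univ.sum fun i : Fin n => ‖(EuclideanSpace.basisFun (Fin n) ℝ).toBasis i‖ := by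
    intro t ht
    rw [← ZSpan.fract_eq_self.2 ht]
    exact ZSpan.norm_fract_le _ _
  obtain ⟨R, hR⟩ : ∃ R : ℝ, ∀ t ∈ D, ‖t‖ ≤ R := ⟨_, hbd⟩
  have hDm : MeasurableSet D := ZSpan.fundamentalDomain_measurableSet _
  have hDb : Bornology.IsBounded D := ZSpan.fundamentalDomain_isBounded _
  have hDf : volume D < ⊤ := hDb.measure_lt_top
  have hinv : VAddInvariantMeasure
      (Submodule.span ℤ (Set.range (EuclideanSpace.basisFun (Fin n) ℝ).toBasis)) (V n) volume :=
    inferInstanceAs (VAddInvariantMeasure (Submodule.span ℤ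
      (Set.range (EuclideanSpace.basisFun (Fin n) ℝ).toBasis)).toAddSubgroup (V n) volume)
  have h1 := (ZSpan.isAddFundamentalDomain (EuclideanSpace.basisFun (Fin n) ℝ).toBasis
    volume).integral_eq_tsum'' k hk
  rw [h1, ← (intLatticeEquiv n).symm.toEquiv.tsum_eq]
  have h2 : ∀ z : Fin n → ℤ, ∀ t : V n, ((intLatticeEquiv n).symm z) +ᵥ t = t + intPoint z := by
    intro z t
    rw [← coe_intLatticeEquiv_symm, add_comm]
    rfl
  have h3 : ∀ (z : Fin n → ℤ) (t : V n),
      k (t + intPoint z) = character (-intPoint m) t * h (t + intPoint z) := by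
    intro z t
    simp only [k, character_add_right, ← map_neg, character_intPoint, mul_one]
  simp only [LinearEquiv.coe_toEquiv, h2, h3]
  -- Sum and integral over the cube are exchanged by absolute convergence: on the bounded cube the
  -- translates of `h` have a uniform summable majorant.
  have hsum := hasSum_integral_of_summable_integral_norm (μ := volume.restrict D)
    (F := fun (z : Fin n → ℤ) (t : V n) => character (-intPoint m) t * h (t + intPoint z))
    (fun z => by
      have := (hk.comp_add_right (intPoint z)).restrict (s := D)
      exact this.congr (.of_forall fun t => h3 z t)) (by
      refine Summable.of_nonneg_of_le (fun z => by positivity) (fun z => ?_)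
        ((summable_intPoint (Nat.lt_succ_self n)).mul_left
          ((1 + R) ^ (n + 1) * (2 ^ (n + 1) * schwartzNorm n (n + 1) 0 h) * volume.real D))
      refine (Real.le_norm_self _).trans ((norm_setIntegral_le_of_norm_le_const
        (C := (1 + R) ^ (n + 1) * (2 ^ (n + 1) * schwartzNorm n (n + 1) 0 h) *
          ((1 + ‖intPoint z‖) ^ (n + 1))⁻¹) hDf fun t ht => ?_).trans_eq (mul_right_comm _ _ _))
      rw [norm_norm, norm_mul, norm_character, one_mul]
      refine (norm_apply_add_le h (n + 1) t _).trans ?_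
      have := hR t ht
      gcongr)
  rw [hsum.tsum_eq]
  refine (integral_cube_eq_fundamentalDomain fun s =>
    UnitAddTorus.mFourier (-m) (torusMk n s) • torusPeriodization h (torusMk n s)).trans ?_
  refine integral_congr_ae (.of_forall fun t => ?_)
  change UnitAddTorus.mFourier (-m) (torusMk n t.ofLp) • torusPeriodization h (torusMk n t.ofLp) = _
  rw [mFourier_torusMk, torusPeriodization_torusMk, map_neg, smul_eq_mul, ← tsum_mul_left]

/-- The Poisson summation formula for Schwartz functions on `ℝⁿ`. -/
lemma hasSum_fourier_intPoint (h : Test n) (t : V n) :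
    HasSum (fun m : Fin n → ℤ => FourierTransform.fourier h (intPoint m) * character (intPoint m) t)
      (∑' m : Fin n → ℤ, h (t + intPoint m)) := by
  -- The Fourier coefficients are samples of the Schwartz function `ĥ` at integer points.
  have hs : Summable (UnitAddTorus.mFourierCoeff (torusPeriodization h)) := by
    refine Summable.of_norm ?_
    simp only [mFourierCoeff_torusPeriodization]
    simpa using summable_norm_apply_add_intPoint (FourierTransform.fourier h) 0
  have h1 := UnitAddTorus.hasSum_mFourier_series_apply_of_summable hs (torusMk n t.ofLp)
  rw [torusPeriodization_torusMk] at h1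
  simpa only [mFourierCoeff_torusPeriodization, mFourier_torusMk, smul_eq_mul] using h1

/-- A `ℤ`-basis of `Λ` is an `ℝ`-basis of the space, so a linear change of variables reduces `Λ` to
the integer lattice. -/
lemma exists_latticeParam (Λ : Submodule ℤ (V n)) [DiscreteTopology Λ] [IsZLattice ℝ Λ] :
    ∃ (L : V n ≃L[ℝ] V n) (e : (Fin n → ℤ) ≃ Λ), ∀ m, L (intPoint m) = e m := by
  have hr : Module.finrank ℤ Λ = n := by
    rw [ZLattice.rank ℝ Λ, finrank_euclideanSpace_fin]
  let b₀ : Module.Basis (Fin n) ℤ Λ := Module.finBasisOfFinrankEq ℤ Λ hr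
  let L : V n ≃ₗ[ℝ] V n :=
    (EuclideanSpace.basisFun (Fin n) ℝ).toBasis.equiv (b₀.ofZLatticeBasis ℝ Λ) (Equiv.refl _)
  refine ⟨L.toContinuousLinearEquiv, b₀.equivFun.symm.toEquiv, fun m => ?_⟩
  change L (intPoint m) = ((b₀.equivFun.symm m : Λ) : V n)
  rw [intPoint_eq_sum, map_sum, Module.Basis.equivFun_symm_apply, ← Submodule.subtype_apply,
    map_sum]
  refine Finset.sum_congr rfl fun i _ => ?_
  rw [map_zsmul, map_zsmul, Module.Basis.equiv_apply, Module.Basis.ofZLatticeBasis_apply]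
  rfl

/-- Poisson summation over a lattice: periodization of Schwartz functions is given by a Fourier
series, whose coefficients decay rapidly. -/
lemma exists_poisson (Λ : Submodule ℤ (V n)) [DiscreteTopology Λ] [IsZLattice ℝ Λ] (K : ℕ) :
    ∃ (k : (Fin n → ℤ) → V n) (a : (Fin n → ℤ) → Test n →L[ℂ] ℂ) (u : (Fin n → ℤ) → ℝ)
      (q : Seminorm ℂ (Test n)), Summable u ∧ Continuous q ∧ (∀ m, 0 ≤ u m) ∧
      (∀ m h, (1 + ‖k m‖) ^ K * ‖a m h‖ ≤ u m * q h) ∧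
      ∀ (h : Test n) (t : V n),
        HasSum (fun m => a m h * character (k m) t) (∑' l : Λ, h (t - l)) := by
  obtain ⟨L, e, he⟩ := exists_latticeParam Λ
  let T : Test n →L[ℂ] Test n := FourierTransform.fourierCLM ℂ (Test n) ∘L
    SchwartzMap.compCLMOfContinuousLinearEquiv ℂ L
  -- Since `⟨m, L⁻¹ t⟩ = ⟨A m, t⟩`, the frequencies `A m` run through the dual lattice.
  let A : V n →L[ℝ] V n := (L.symm : V n →L[ℝ] V n).adjoint
  -- Of the decay `K + (n + 1)` of the Fourier transform, `K` powers pay for the weight and `n + 1`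
  -- for summability in `m`.
  let q : Seminorm ℂ (Test n) := ((1 + ‖A‖₊) ^ K * 2 ^ (K + (n + 1))) •
    (schwartzNorm n (K + (n + 1)) 0).comp T.toLinearMap
  refine ⟨fun m => A (intPoint m),
    fun m => (BoundedContinuousFunction.evalCLM ℂ (intPoint m)) ∘L
      SchwartzMap.toBoundedContinuousFunctionCLM ℂ (V n) ℂ ∘L T,
    fun m => ((1 + ‖intPoint m‖) ^ (n + 1))⁻¹, q, summable_intPoint (Nat.lt_succ_self n),
    ((continuous_schwartzNorm _ _).comp T.continuous).const_smul _, fun m => by positivity,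
    fun m h => ?_, fun h t => ?_⟩
  · change (1 + ‖A (intPoint m)‖) ^ K * ‖T h (intPoint m)‖ ≤
      ((1 + ‖intPoint m‖) ^ (n + 1))⁻¹ *
        (((1 + ‖A‖) ^ K * 2 ^ (K + (n + 1))) * schwartzNorm n (K + (n + 1)) 0 (T h))
    rw [inv_mul_eq_div, le_div_iff₀ (by positivity)]
    have h1 := one_add_pow_mul_le_schwartzNorm (k := K + (n + 1)) le_rfl (T h) (intPoint m) (m := 0)
    rw [norm_iteratedFDeriv_zero] at h1
    have h2 : 1 + ‖A (intPoint m)‖ ≤ (1 + ‖A‖) * (1 + ‖intPoint m‖) := by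
      have := A.le_opNorm (intPoint m)
      nlinarith [norm_nonneg A, norm_nonneg (intPoint m)]
    calc (1 + ‖A (intPoint m)‖) ^ K * ‖T h (intPoint m)‖ * (1 + ‖intPoint m‖) ^ (n + 1)
        ≤ ((1 + ‖A‖) * (1 + ‖intPoint m‖)) ^ K * ‖T h (intPoint m)‖ *
          (1 + ‖intPoint m‖) ^ (n + 1) := by gcongr
      _ = (1 + ‖A‖) ^ K * ((1 + ‖intPoint m‖) ^ (K + (n + 1)) * ‖T h (intPoint m)‖) := by
        rw [mul_pow, pow_add]; ring
      _ ≤ (1 + ‖A‖) ^ K * (2 ^ (K + (n + 1)) * schwartzNorm n (K + (n + 1)) 0 (T h)) := by gcongr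
      _ = _ := by ring
  · have h1 := hasSum_fourier_intPoint (SchwartzMap.compCLMOfContinuousLinearEquiv ℂ L h) (L.symm t)
    have h2 : ∑' m : Fin n → ℤ, SchwartzMap.compCLMOfContinuousLinearEquiv ℂ L h
        (L.symm t + intPoint m) = ∑' l : Λ, h (t - l) := by
      -- The sign accounts for `h (t - l)` here against `h (t + m)` in the formula on the integer
      -- lattice.
      rw [← (e.trans (Equiv.neg Λ)).tsum_eq]
      refine tsum_congr fun m => ?_
      simp [he]
    rw [h2] at h1
    refine h1.congr_fun fun m => ?_
    change T h (intPoint m) * character (A (intPoint m)) t = _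
    congr 1
    simp only [character, A, ContinuousLinearMap.adjoint_inner_left]
    rfl

/-! ### The kernel of the frame operator -/

section Shear

variable {𝕜 : Type*} [RCLike 𝕜] {f g : V n → 𝕜}

/-- This is the integrand of the convolution of `f` with the reflection of `g`. -/
lemma integrable_mul_comp_sub (hf : Integrable f) (hg : Integrable g) :
    Integrable (fun p : V n × V n => f p.2 * g (p.2 - p.1)) (volume.prod volume) := by
  have h := hf.convolution_integrand (ContinuousLinearMap.mul ℝ 𝕜) hg.comp_neg
  refine h.congr (.of_forall fun p => ?_)
  simp

lemma integral_mul_comp_sub (hf : Integrable f) (hg : Integrable g) :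
    ∫ p : V n × V n, f p.2 * g (p.2 - p.1) ∂(volume.prod volume) = (∫ t, f t) * ∫ t, g t := by
  rw [integral_prod_symm _ (integrable_mul_comp_sub hf hg), ← integral_mul_const]
  refine integral_congr_ae (.of_forall fun t => ?_)
  simp only [integral_const_mul]
  rw [integral_sub_left_eq_self]

end Shear

lemma exists_integral_norm_mulTest_translateTest_le (N : ℕ) (η ψ : Test n) : ∃ C : ℝ, 0 ≤ C ∧
    ∀ x : V n, ∫ t, ‖mulTest η (translateTest x ψ) t‖ ≤ C * ((1 + ‖x‖) ^ N)⁻¹ := by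
  obtain ⟨p, -, hp⟩ := exists_norm_mulTest_translateTest_le
    (SchwartzMap.toLpCLM ℂ ℂ 1 (volume : Measure (V n))) N
  refine ⟨p η * p ψ, by positivity, fun x => ?_⟩
  have h := hp η ψ x
  rw [SchwartzMap.toLpCLM_apply, SchwartzMap.norm_toLp_one] at h
  rwa [← div_eq_mul_inv, le_div_iff₀' (by positivity)]

lemma integrable_one_add_norm_pow_inv : Integrable fun x : V n => ((1 + ‖x‖) ^ (n + 1))⁻¹ := by
  have h := integrable_one_add_norm (E := V n) (μ := volume) (r := (n + 1 : ℕ)) (by simp)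
  refine h.congr (.of_forall fun x => ?_)
  simp only
  rw [Real.rpow_neg (by positivity), Real.rpow_natCast]

lemma ofTest_comm (φ θ : Test n) : ofTest φ θ = ofTest θ φ := by
  simp only [ofTest_apply, mul_comm]

/-- The sum over the lattice of products of periodized kernels, computed by unfolding. -/
lemma integral_tsum_lattice_eq (Λ : Submodule ℤ (V n)) [DiscreteTopology Λ] [IsZLattice ℝ Λ]
    (φ ψ θ η : Test n) :
    ∫ p : V n × V n, ∑' l : Λ, mulTest η (translateTest l ψ) p.2 *
        mulTest θ (translateTest l φ) (p.2 - p.1) ∂(volume.prod volume) =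
      ∑' l : Λ, ofTest θ (translateTest l φ) * ofTest (translateTest l ψ) η := by
  obtain ⟨C, hC0, hC⟩ := exists_integral_norm_mulTest_translateTest_le (n + 1) η ψ
  obtain ⟨D, hD0, hD⟩ := exists_integral_norm_mulTest_translateTest_le 0 θ φ
  have h := hasSum_integral_of_summable_integral_norm (μ := (volume : Measure (V n)).prod volume)
    (F := fun (l : Λ) (p : V n × V n) => mulTest η (translateTest l ψ) p.2 *
        mulTest θ (translateTest l φ) (p.2 - p.1))
    (fun l => integrable_mul_comp_sub (SchwartzMap.integrable _) (SchwartzMap.integrable _)) (by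
      refine Summable.of_nonneg_of_le (fun l => by positivity) (fun l => ?_)
        ((summable_one_add_norm_pow_inv Λ (Nat.lt_succ_self n)).mul_left (C * D))
      simp only [norm_mul]
      rw [integral_mul_comp_sub (f := fun t => ‖mulTest η (translateTest (l : V n) ψ) t‖)
        (g := fun t => ‖mulTest θ (translateTest (l : V n) φ) t‖)
        (SchwartzMap.integrable _).norm (SchwartzMap.integrable _).norm]
      have h1 := hC l
      have h2 := hD l
      rw [pow_zero, inv_one, mul_one] at h2
      calc _ ≤ (C * ((1 + ‖(l : V n)‖) ^ (n + 1))⁻¹) * D := by gcongr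
        _ = _ := mul_right_comm _ _ _)
  rw [← h.tsum_eq]
  refine tsum_congr fun l => ?_
  rw [integral_mul_comp_sub (SchwartzMap.integrable _) (SchwartzMap.integrable _), mul_comm,
    ofTest_comm _ η]
  rfl

lemma continuous_timeFreqShift_left (ξ : V n) (θ : Test n) :
    Continuous fun x : V n => timeFreqShift x ξ θ :=
  (modulateTest ξ).continuous.comp (continuous_translateTest θ)

lemma timeFreqShift_apply (x ξ : V n) (θ : Test n) (t : V n) :
    timeFreqShift x ξ θ t = character ξ t * θ (t - x) := by
  rw [timeFreqShift, modulateTest_apply, translateTest_apply]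

/-- The operator `θ ↦ ∑_λ ⟨θ, T_λ φ⟩ T_λ ψ` as a superposition of time-frequency shifts. -/
lemma hasSum_integral_timeFreqShift (Λ : Submodule ℤ (V n)) [DiscreteTopology Λ] [IsZLattice ℝ Λ]
    {k : (Fin n → ℤ) → V n} {a : (Fin n → ℤ) → Test n →L[ℂ] ℂ} {u : (Fin n → ℤ) → ℝ}
    {q : Seminorm ℂ (Test n)} (hu : Summable u) (hq : Continuous q) (hu0 : ∀ m, 0 ≤ u m)
    (ha : ∀ m h, ‖a m h‖ ≤ u m * q h)
    (hP : ∀ (h : Test n) (t : V n),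
      HasSum (fun m => a m h * character (k m) t) (∑' l : Λ, h (t - l))) (φ ψ θ η : Test n) :
    HasSum (fun m => ∫ x : V n, a m (mulTest ψ (translateTest x φ)) *
        ofTest (timeFreqShift x (k m) θ) η)
      (∑' l : Λ, ofTest θ (translateTest l φ) * ofTest (translateTest l ψ) η) := by
  obtain ⟨p, -, hp⟩ := exists_mulTest_translateTest_le hq (n + 1)
  set P := p ψ * p φ
  have hP0 : 0 ≤ P := by positivity
  set M := SchwartzMap.seminorm ℂ 0 0 θ
  have hM0 : 0 ≤ M := apply_nonneg _ _
  -- The integrand as a function of `(x, t)`, with `s = t - x` the argument of `θ`.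
  let F : (Fin n → ℤ) → V n × V n → ℂ := fun m p =>
    a m (mulTest ψ (translateTest p.1 φ)) * (timeFreqShift p.1 (k m) θ p.2 * η p.2)
  have hFc : ∀ m, Continuous (F m) := by
    intro m
    have h1 : Continuous fun p : V n × V n => a m (mulTest ψ (translateTest p.1 φ)) :=
      (a m).continuous.comp ((mulTest ψ).continuous.comp
        ((continuous_translateTest φ).comp continuous_fst))
    have h2 := continuous_character (k m)
    have h3 := θ.continuous
    have h4 := η.continuous
    simp only [F, timeFreqShift_apply]
    exact h1.mul (by fun_prop)
  have hbd : ∀ m p, ‖F m p‖ ≤ u m * (P * M) * (((1 + ‖p.1‖) ^ (n + 1))⁻¹ * ‖η p.2‖) := by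
    intro m x
    have h1 : q (mulTest ψ (translateTest x.1 φ)) ≤ P * ((1 + ‖x.1‖) ^ (n + 1))⁻¹ := by
      rw [← div_eq_mul_inv, le_div_iff₀' (by positivity)]
      exact hp ψ φ x.1
    have h2 : ‖θ (x.2 - x.1)‖ ≤ M := SchwartzMap.norm_le_seminorm ℂ θ _
    have h3 := ha m (mulTest ψ (translateTest x.1 φ))
    have h4 := hu0 m
    simp only [F, timeFreqShift_apply, norm_mul, norm_character, one_mul]
    calc _ ≤ (u m * (P * ((1 + ‖x.1‖) ^ (n + 1))⁻¹)) * (M * ‖η x.2‖) := by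
          gcongr
          exact h3.trans (by gcongr)
      _ = _ := by ring
  have hB : Integrable (fun p : V n × V n => ((1 + ‖p.1‖) ^ (n + 1))⁻¹ * ‖η p.2‖)
      (volume.prod volume) :=
    integrable_one_add_norm_pow_inv.mul_prod (SchwartzMap.integrable η).norm
  have hFi : ∀ m, Integrable (F m) (volume.prod volume) := fun m =>
    (hB.const_mul (u m * (P * M))).mono' (hFc m).aestronglyMeasurable (.of_forall (hbd m))
  have h := hasSum_integral_of_summable_integral_norm hFi (by
    refine Summable.of_nonneg_of_le (fun l => by positivity) (fun m => ?_)
      (hu.mul_right (P * M * ∫ p : V n × V n, ((1 + ‖p.1‖) ^ (n + 1))⁻¹ * ‖η p.2‖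
        ∂(volume.prod volume)))
    refine (integral_mono (hFi m).norm (hB.const_mul (u m * (P * M))) (hbd m)).trans_eq ?_
    rw [integral_const_mul, mul_assoc])
  -- Poisson summation at `t` for `ψ · T_x φ`; the factors of each lattice term are then regrouped
  -- by the arguments `t` and `t - x`.
  have h5 : ∀ x : V n × V n, ∑' m, F m x = ∑' l : Λ, mulTest η (translateTest l ψ) x.2 *
        mulTest θ (translateTest l φ) (x.2 - x.1) := by
    intro x
    have h6 := (hP (mulTest ψ (translateTest x.1 φ)) x.2).mul_right (θ (x.2 - x.1) * η x.2)
    rw [← tsum_mul_right] at h6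
    refine Eq.trans (HasSum.tsum_eq (h6.congr_fun fun m => ?_)) (tsum_congr fun l => ?_)
    · simp only [F, timeFreqShift_apply]
      ring
    · simp only [mulTest_apply, translateTest_apply]
      rw [sub_right_comm x.2]
      ring
  simp only [h5] at h
  rw [integral_tsum_lattice_eq] at h
  refine h.congr_fun fun m => ?_
  rw [integral_prod _ (hFi m)]
  refine integral_congr_ae (.of_forall fun x => ?_)
  simp only [F, integral_const_mul, ofTest_apply]

/-! ### Time-frequency shifts on `E` -/

lemma translate_ofTest (x : V n) (θ : Test n) :
    translate x (ofTest θ) = ofTest (translateTest x θ) := by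
  ext η
  change ofTest θ (translateTest (-x) η) = _
  rw [ofTest_apply, ofTest_apply, ← integral_sub_right_eq_self _ x]
  refine integral_congr_ae (.of_forall fun t => ?_)
  simp [translateTest_apply]

lemma modulate_ofTest (ξ : V n) (θ : Test n) :
    modulate ξ (ofTest θ) = ofTest (modulateTest ξ θ) := by
  ext η
  change ofTest θ (modulateTest ξ η) = _
  rw [ofTest_apply, ofTest_apply]
  refine integral_congr_ae (.of_forall fun t => ?_)
  simp only [modulateTest_apply]
  ring

section

variable {E : Type*} [NormedAddCommGroup E] [NormedSpace ℂ E]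

/-- `E` is invariant under translations and modulations, with polynomially bounded norms. -/
structure ShiftBounded (X : DistSpace n E) : Prop where
  translate : ∃ (C : ℝ) (K : ℕ), 0 ≤ C ∧ ∀ (x : V n) (e : E), ∃ e' : E,
    X.incl e' = translate x (X.incl e) ∧ ‖e'‖ ≤ C * (1 + ‖x‖) ^ K * ‖e‖
  modulate : ∃ (C : ℝ) (K : ℕ), 0 ≤ C ∧ ∀ (ξ : V n) (e : E), ∃ e' : E,
    X.incl e' = modulate ξ (X.incl e) ∧ ‖e'‖ ≤ C * (1 + ‖ξ‖) ^ K * ‖e‖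

lemma one_add_norm_rpow_le (x : V n) (τ : ℝ) : (1 + ‖x‖) ^ τ ≤ (1 + ‖x‖) ^ ⌈τ⌉₊ := by
  rw [← Real.rpow_natCast]
  exact Real.rpow_le_rpow_of_exponent_le (by linarith [norm_nonneg x]) (Nat.le_ceil τ)

lemma IsTMIB.shiftBounded [CompleteSpace E] {X : DistSpace n E} (hX : IsTMIB X) :
    ShiftBounded X := by
  constructor
  · obtain ⟨τ, C, -, hC, h⟩ := hX.translate_bound
    refine ⟨C, ⌈τ⌉₊, hC.le, fun x e => ?_⟩
    obtain ⟨e', he'⟩ := hX.translate_mem x e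
    refine ⟨e', he', (h x e e' he').trans ?_⟩
    gcongr
    exact one_add_norm_rpow_le x τ
  · obtain ⟨τ, C, -, hC, h⟩ := hX.modulate_bound
    refine ⟨C, ⌈τ⌉₊, hC.le, fun x e => ?_⟩
    obtain ⟨e', he'⟩ := hX.modulate_mem x e
    refine ⟨e', he', (h x e e' he').trans ?_⟩
    gcongr
    exact one_add_norm_rpow_le x τ

/-- An operator on distributions which preserves `E` with a norm bound acts on `E` continuously. -/
lemma DistSpace.exists_clm (X : DistSpace n E) (S : Test n →L[ℂ] Test n) {C : ℝ}
    (h : ∀ e : E, ∃ e' : E, X.incl e' = X.incl e ∘L S ∧ ‖e'‖ ≤ C * ‖e‖) :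
    ∃ T : E →L[ℂ] E, ∀ e, X.incl (T e) = X.incl e ∘L S ∧ ‖T e‖ ≤ C * ‖e‖ := by
  choose f hf hC using h
  let T : E →ₗ[ℂ] E :=
    { toFun := f
      map_add' := fun a b => X.injective_incl (by simp [hf, ContinuousLinearMap.add_comp])
      map_smul' := fun a b => X.injective_incl (by simp [hf, ContinuousLinearMap.smul_comp]) }
  exact ⟨T.mkContinuous C hC, fun e => ⟨hf e, hC e⟩⟩

/-- Evaluation of the elements of `E` at a test function. -/
def DistSpace.eval (X : DistSpace n E) (φ : Test n) : E →L[ℂ] ℂ where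
  toFun e := X.incl e φ
  map_add' := by simp
  map_smul' := by simp
  cont := (continuous_eval_const φ).comp X.incl.continuous

@[simp] lemma DistSpace.eval_apply (X : DistSpace n E) (φ : Test n) (e : E) :
    X.eval φ e = X.incl e φ := rfl

lemma DistSpace.ext_incl (X : DistSpace n E) {e e' : E}
    (h : ∀ φ, X.incl e φ = X.incl e' φ) : e = e' :=
  X.injective_incl (ContinuousLinearMap.ext h)

/-- Since `⟨e, T_x φ⟩ = ⟨T_{-x} e, φ⟩`, the growth in `x` is that of the translation norms on `E`.
-/
lemma ShiftBounded.exists_norm_incl_translateTest_le {X : DistSpace n E} (hX : ShiftBounded X)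
    (φ : Test n) : ∃ (C : ℝ) (K : ℕ), 0 ≤ C ∧ ∀ (x : V n) (e : E),
      ‖X.incl e (translateTest x φ)‖ ≤ C * (1 + ‖x‖) ^ K * ‖e‖ := by
  obtain ⟨C, K, hC, h⟩ := hX.translate
  refine ⟨‖X.eval φ‖ * C, K, by positivity, fun x e => ?_⟩
  obtain ⟨e', he', hb⟩ := h (-x) e
  have h1 : X.incl e (translateTest x φ) = X.eval φ e' := by
    rw [DistSpace.eval_apply, he', Gabor.translate, neg_neg]
    rfl
  rw [h1]
  rw [norm_neg] at hb
  calc _ ≤ ‖X.eval φ‖ * ‖e'‖ := (X.eval φ).le_opNorm e'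
    _ ≤ ‖X.eval φ‖ * (C * (1 + ‖x‖) ^ K * ‖e‖) := by gcongr
    _ = _ := by ring

lemma exists_norm_ofTest_translateTest_le (ψ η : Test n) (N : ℕ) : ∃ C : ℝ, 0 ≤ C ∧
    ∀ x : V n, ‖ofTest (translateTest x ψ) η‖ ≤ C * ((1 + ‖x‖) ^ N)⁻¹ := by
  obtain ⟨C, hC, h⟩ := exists_integral_norm_mulTest_translateTest_le N η ψ
  refine ⟨C, hC, fun x => ?_⟩
  rw [ofTest_comm]
  exact (norm_integral_le_integral_norm _).trans (h x)

/-- `∑_λ ⟨e, T_λ φ⟩ ⟨T_λ ψ, θ⟩` converges absolutely to a continuous functional of `e`. -/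
lemma ShiftBounded.exists_hasSum {X : DistSpace n E} (hX : ShiftBounded X)
    (Λ : Submodule ℤ (V n)) [DiscreteTopology Λ] [IsZLattice ℝ Λ] (φ ψ θ : Test n) :
    ∃ S : E →L[ℂ] ℂ, ∀ e, HasSum (fun l : Λ => X.incl e (translateTest l φ) *
      ofTest (translateTest l ψ) θ) (S e) := by
  obtain ⟨C, K, hC, h⟩ := hX.exists_norm_incl_translateTest_le φ
  -- `K` powers cancel the growth of `⟨e, T_λ φ⟩`, and `n + 1` make the lattice sum converge.
  obtain ⟨D, hD, h'⟩ := exists_norm_ofTest_translateTest_le ψ θ (K + (n + 1))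
  have hs : Summable fun l : Λ => ofTest (translateTest l ψ) θ • X.eval (translateTest l φ) := by
    refine Summable.of_norm_bounded (g := fun l : Λ => C * D * ((1 + ‖(l : V n)‖) ^ (n + 1))⁻¹)
      ((summable_one_add_norm_pow_inv Λ (Nat.lt_succ_self n)).mul_left (C * D)) fun l => ?_
    refine ContinuousLinearMap.opNorm_le_bound _ (by positivity) fun e => ?_
    rw [smul_apply, norm_smul, DistSpace.eval_apply]
    calc _ ≤ (D * ((1 + ‖(l : V n)‖) ^ (K + (n + 1)))⁻¹) * (C * (1 + ‖(l : V n)‖) ^ K * ‖e‖) := by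
          gcongr
          · exact h' l
          · exact h l e
      _ = _ := by
        have : (1 + ‖(l : V n)‖) ^ K ≠ 0 := by positivity
        rw [pow_add]
        field_simp
  refine ⟨∑' l : Λ, ofTest (translateTest l ψ) θ • X.eval (translateTest l φ), fun e => ?_⟩
  have h1 := (ContinuousLinearMap.apply ℂ ℂ e).hasSum hs.hasSum
  refine h1.congr_fun fun l => ?_
  simp [mul_comm]

end

/-! ### The frame operator on a TMIB -/

section TMIB

variable {F : Type*} [NormedAddCommGroup F] [NormedSpace ℂ F]

lemma ShiftBounded.exists_norm_timeFreqShift_le {Y : DistSpace n F} (hY : ShiftBounded Y)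
    {j : Test n →L[ℂ] F} (hj : ∀ φ, Y.incl (j φ) = ofTest φ) :
    ∃ (C : ℝ) (K K' : ℕ), 0 ≤ C ∧ ∀ (x ξ : V n) (θ : Test n),
      ‖j (timeFreqShift x ξ θ)‖ ≤ C * (1 + ‖x‖) ^ K * (1 + ‖ξ‖) ^ K' * ‖j θ‖ := by
  obtain ⟨C, K, hC, h⟩ := hY.translate
  obtain ⟨C', K', hC', h'⟩ := hY.modulate
  refine ⟨C * C', K, K', by positivity, fun x ξ θ => ?_⟩
  obtain ⟨e, he, hb⟩ := h x (j θ)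
  obtain ⟨e', he', hb'⟩ := h' ξ (j (translateTest x θ))
  have h1 : e = j (translateTest x θ) := Y.injective_incl (by rw [he, hj, hj, translate_ofTest])
  have h2 : e' = j (timeFreqShift x ξ θ) :=
    Y.injective_incl (by rw [he', hj, hj, modulate_ofTest, timeFreqShift])
  subst h1 h2
  calc _ ≤ _ := hb'
    _ ≤ C' * (1 + ‖ξ‖) ^ K' * (C * (1 + ‖x‖) ^ K * ‖j θ‖) := by gcongr
    _ = _ := by ring

/-- The superposition of time-frequency shifts converges absolutely in `F`: the Poisson coefficients
beat the growth of the shift norms. Restricting to Schwartz `θ` makes the integrand continuous, and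
the bound involves only the `F`-norm of `θ`, as extension by density requires. -/
lemma ShiftBounded.exists_frameOp_test [CompleteSpace F] {Y : DistSpace n F} (hY : ShiftBounded Y)
    {j : Test n →L[ℂ] F} (hj : ∀ φ, Y.incl (j φ) = ofTest φ)
    (Λ : Submodule ℤ (V n)) [DiscreteTopology Λ] [IsZLattice ℝ Λ] (φ ψ : Test n) :
    ∃ C : ℝ, ∀ θ : Test n, ∃ e : F, ‖e‖ ≤ C * ‖j θ‖ ∧ ∀ η : Test n,
      Y.incl e η = ∑' l : Λ, ofTest θ (translateTest l φ) * ofTest (translateTest l ψ) η := by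
  obtain ⟨C, K, K', hC, hCb⟩ := hY.exists_norm_timeFreqShift_le hj
  -- The weight `K'` matches the growth of modulations; on the next line `K` matches that of
  -- translations and `n + 1` gives integrability in `x`.
  obtain ⟨k, a, u, q, hu, hq, hu0, ha, hP⟩ := exists_poisson Λ K'
  obtain ⟨p, -, hp⟩ := exists_mulTest_translateTest_le hq (K + (n + 1))
  have ha' : ∀ m h, ‖a m h‖ ≤ u m * q h := fun m h =>
    (le_mul_of_one_le_left (norm_nonneg _) (one_le_pow₀ (by simp))).trans (ha m h)
  set P := p ψ * p φ
  have hP0 : 0 ≤ P := by positivity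
  set J : ℝ := ∫ x : V n, ((1 + ‖x‖) ^ (n + 1))⁻¹
  let G : Test n → (Fin n → ℤ) → V n → F := fun θ m x =>
    a m (mulTest ψ (translateTest x φ)) • j (timeFreqShift x (k m) θ)
  have hGc : ∀ θ m, Continuous (G θ m) := fun θ m =>
    ((a m).continuous.comp ((mulTest ψ).continuous.comp (continuous_translateTest φ))).smul
      (j.continuous.comp (continuous_timeFreqShift_left _ θ))
  have hGb : ∀ θ m x, ‖G θ m x‖ ≤ u m * (P * C * ‖j θ‖) * ((1 + ‖x‖) ^ (n + 1))⁻¹ := by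
    intro θ m x
    have h1 := ha m (mulTest ψ (translateTest x φ))
    have h2 : q (mulTest ψ (translateTest x φ)) ≤ P * ((1 + ‖x‖) ^ (K + (n + 1)))⁻¹ := by
      rw [← div_eq_mul_inv, le_div_iff₀' (by positivity)]
      exact hp ψ φ x
    have h3 := hu0 m
    rw [norm_smul]
    calc _ ≤ ‖a m (mulTest ψ (translateTest x φ))‖ *
          (C * (1 + ‖x‖) ^ K * (1 + ‖k m‖) ^ K' * ‖j θ‖) := by
          gcongr
          exact hCb _ _ _
      _ = ((1 + ‖k m‖) ^ K' * ‖a m (mulTest ψ (translateTest x φ))‖) *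
          (C * (1 + ‖x‖) ^ K * ‖j θ‖) := by ring
      _ ≤ (u m * (P * ((1 + ‖x‖) ^ (K + (n + 1)))⁻¹)) * (C * (1 + ‖x‖) ^ K * ‖j θ‖) := by
          refine mul_le_mul_of_nonneg_right (h1.trans ?_) (by positivity)
          gcongr
      _ = _ := by
        have : (1 + ‖x‖) ^ K ≠ 0 := by positivity
        rw [pow_add]
        field_simp
  have hGi : ∀ θ m, Integrable (G θ m) := fun θ m =>
    (integrable_one_add_norm_pow_inv.const_mul (u m * (P * C * ‖j θ‖))).mono'
      (hGc θ m).aestronglyMeasurable (.of_forall (hGb θ m))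
  have hIb : ∀ θ m, ‖∫ x, G θ m x‖ ≤ u m * (P * C * J * ‖j θ‖) := by
    intro θ m
    refine (norm_integral_le_of_norm_le
      (integrable_one_add_norm_pow_inv.const_mul (u m * (P * C * ‖j θ‖)))
      (.of_forall (hGb θ m))).trans_eq ?_
    rw [integral_const_mul]
    ring
  refine ⟨(∑' m, u m) * (P * C * J), fun θ => ?_⟩
  have hs := hu.mul_right (P * C * J * ‖j θ‖)
  refine ⟨∑' m, ∫ x, G θ m x, ?_, fun η => ?_⟩
  · rw [mul_assoc, ← tsum_mul_right]
    exact tsum_of_norm_bounded hs.hasSum (hIb θ)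
  · have h1 := (Y.eval η).hasSum (Summable.of_norm_bounded hs (hIb θ)).hasSum
    refine h1.unique ((hasSum_integral_timeFreqShift Λ hu hq hu0 ha' hP φ ψ θ η).congr_fun
      fun m => ?_)
    rw [← ContinuousLinearMap.integral_comp_comm _ (hGi θ m)]
    simp [G, hj]

lemma IsTMIB.exists_frameOp [CompleteSpace F] {Y : DistSpace n F} (hY : IsTMIB Y)
    (Λ : Submodule ℤ (V n)) [DiscreteTopology Λ] [IsZLattice ℝ Λ] (φ ψ : Test n) :
    ∃ A : F →L[ℂ] F, ∀ (e : F) (θ : Test n),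
      HasSum (fun l : Λ => Y.incl e (translateTest l φ) * ofTest (translateTest l ψ) θ)
        (Y.incl (A e) θ) := by
  obtain ⟨j, hd, hj⟩ := hY.dense_incl
  obtain ⟨C, hC⟩ := hY.shiftBounded.exists_frameOp_test hj Λ φ ψ
  choose S hS using fun θ => hY.shiftBounded.exists_hasSum Λ φ ψ θ
  choose f hf hf' using hC
  replace hf' : ∀ θ η, Y.incl (f θ) η = S η (j θ) := fun θ η => by
    rw [hf', ← hj, (hS η (j θ)).tsum_eq]
  let A₀ : Test n →ₗ[ℂ] F :=
    { toFun := f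
      map_add' := fun a b => Y.ext_incl (by simp [hf'])
      map_smul' := fun a b => Y.ext_incl (by simp [hf']) }
  have hA₀ : ∀ θ, A₀.extendOfNorm j.toLinearMap (j θ) = f θ := fun θ =>
    LinearMap.extendOfNorm_eq (f := A₀) (e := j.toLinearMap) hd ⟨C, hf⟩ θ
  refine ⟨A₀.extendOfNorm j.toLinearMap, fun e θ => ?_⟩
  -- Both sides are continuous in `e` and agree on the dense image of the Schwartz space.
  have h1 : (fun e => Y.incl (A₀.extendOfNorm j.toLinearMap e) θ) = S θ := by
    refine hd.equalizer ((Y.eval θ).continuous.comp (ContinuousLinearMap.continuous _))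
      (S θ).continuous (funext fun η => ?_)
    simp only [Function.comp_apply, hA₀, hf']
  rw [congrFun h1 e]
  exact hS θ e

end TMIB

/-! ### The frame operator on a DTMIB, by transposition -/

section Frame

variable {E : Type*} [NormedAddCommGroup E] [NormedSpace ℂ E]

/-- For all `φ` and `ψ`, the operator `e ↦ ∑_λ ⟨e, T_λ φ⟩ T_λ ψ` is bounded on `E`. -/
def FrameBounded (X : DistSpace n E) (Λ : Submodule ℤ (V n)) : Prop :=
  ∀ φ ψ : Test n, ∃ C : ℝ, 0 ≤ C ∧ ∀ e : E, ∃ e' : E, ‖e'‖ ≤ C * ‖e‖ ∧ ∀ θ : Test n,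
    HasSum (fun l : Λ => X.incl e (translateTest l φ) * ofTest (translateTest l ψ) θ) (X.incl e' θ)

lemma IsTMIB.frameBounded [CompleteSpace E] {X : DistSpace n E} (hX : IsTMIB X)
    (Λ : Submodule ℤ (V n)) [DiscreteTopology Λ] [IsZLattice ℝ Λ] : FrameBounded X Λ := by
  intro φ ψ
  obtain ⟨A, hA⟩ := hX.exists_frameOp Λ φ ψ
  exact ⟨‖A‖, norm_nonneg _, fun e => ⟨A e, A.le_opNorm e, hA e⟩⟩

lemma IsDTMIB.shiftBounded {X : DistSpace n E} (hX : IsDTMIB X) : ShiftBounded X := by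
  obtain ⟨F, _, _, _, Y, hY, Φ, hΦ⟩ := hX
  obtain ⟨j, -, hj⟩ := hY.dense_incl
  -- If `T` on `F` extends `S` on Schwartz functions, its transpose on `E` acts as precomposition
  -- with `S`, with no larger norm bound.
  have key : ∀ (S : Test n →L[ℂ] Test n) (T : F →L[ℂ] F) (D : ℝ), 0 ≤ D →
      (∀ φ, T (j φ) = j (S φ)) → (∀ u, ‖T u‖ ≤ D * ‖u‖) →
      ∀ e : E, ∃ e' : E, X.incl e' = X.incl e ∘L S ∧ ‖e'‖ ≤ D * ‖e‖ := by
    intro S T D hD hT hb e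
    refine ⟨Φ.symm (Φ e ∘L T), ?_, ?_⟩
    · ext φ
      rw [hΦ _ φ (j φ) (hj φ), Φ.apply_symm_apply, ContinuousLinearMap.comp_apply,
        ContinuousLinearMap.comp_apply, hT, hΦ _ (S φ) (j (S φ)) (hj _)]
    · rw [Φ.symm.norm_map, mul_comm]
      refine (ContinuousLinearMap.opNorm_comp_le _ _).trans ?_
      rw [Φ.norm_map]
      gcongr
      exact T.opNorm_le_bound hD hb
  constructor
  · obtain ⟨C, K, hC, h⟩ := hY.shiftBounded.translate
    refine ⟨C, K, hC, fun x => ?_⟩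
    -- Translation by `x` on `E` is the transpose of translation by `-x` on `F`.
    obtain ⟨T, hT⟩ := Y.exists_clm (translateTest (- -x)) (h (-x))
    refine key (translateTest (-x)) T _ (by positivity) (fun φ => Y.injective_incl ?_)
      fun u => ?_
    · rw [(hT _).1, hj, hj]
      exact translate_ofTest (-x) φ
    · simpa using (hT u).2
  · obtain ⟨C, K, hC, h⟩ := hY.shiftBounded.modulate
    refine ⟨C, K, hC, fun ξ => ?_⟩
    obtain ⟨T, hT⟩ := Y.exists_clm (modulateTest ξ) (h ξ)
    refine key (modulateTest ξ) T _ (by positivity) (fun φ => Y.injective_incl ?_)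
      fun u => (hT u).2
    rw [(hT _).1, hj, hj]
    exact modulate_ofTest ξ φ

/-- Transposition exchanges the analysing and synthesizing windows, so no density in `E` is needed.
-/
lemma IsDTMIB.frameBounded {X : DistSpace n E} (hX : IsDTMIB X)
    (Λ : Submodule ℤ (V n)) [DiscreteTopology Λ] [IsZLattice ℝ Λ] : FrameBounded X Λ := by
  obtain ⟨F, _, _, _, Y, hY, Φ, hΦ⟩ := hX
  obtain ⟨j, -, hj⟩ := hY.dense_incl
  intro φ ψ
  obtain ⟨A, hA⟩ := hY.exists_frameOp Λ ψ φ
  refine ⟨‖A‖, norm_nonneg _, fun e => ⟨Φ.symm (Φ e ∘L A), ?_, fun θ => ?_⟩⟩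
  · rw [Φ.symm.norm_map, mul_comm]
    exact (ContinuousLinearMap.opNorm_comp_le _ _).trans_eq (by rw [Φ.norm_map])
  -- Norm convergence in `F` is needed, since an arbitrary functional on `F` has to be applied term
  -- by term.
  · have hs : Summable fun l : Λ => ofTest θ (translateTest l ψ) • j (translateTest l φ) := by
      obtain ⟨C, K, hC, h⟩ := hY.shiftBounded.translate
      obtain ⟨D, hD, h'⟩ := exists_norm_ofTest_translateTest_le ψ θ (K + (n + 1))
      refine Summable.of_norm_bounded
        (g := fun l : Λ => C * D * ‖j φ‖ * ((1 + ‖(l : V n)‖) ^ (n + 1))⁻¹)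
        ((summable_one_add_norm_pow_inv Λ (Nat.lt_succ_self n)).mul_left _) fun l => ?_
      obtain ⟨u, hu, hub⟩ := h l (j φ)
      have h1 : u = j (translateTest l φ) :=
        Y.injective_incl (by rw [hu, hj, hj, translate_ofTest])
      subst h1
      rw [norm_smul, ofTest_comm]
      calc _ ≤ (D * ((1 + ‖(l : V n)‖) ^ (K + (n + 1)))⁻¹) *
              (C * (1 + ‖(l : V n)‖) ^ K * ‖j φ‖) := by
            gcongr
            exact h' l
        _ = _ := by
          have : (1 + ‖(l : V n)‖) ^ K ≠ 0 := by positivity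
          rw [pow_add]
          field_simp
    have h1 : A (j θ) = ∑' l : Λ, ofTest θ (translateTest l ψ) • j (translateTest l φ) := by
      refine Y.ext_incl fun η => ?_
      have h2 := (Y.eval η).hasSum hs.hasSum
      refine HasSum.unique ?_ h2
      refine (hA (j θ) η).congr_fun fun l => ?_
      simp [hj]
    have h3 := (Φ e).hasSum hs.hasSum
    rw [← h1] at h3
    rw [hΦ _ θ (j θ) (hj θ), Φ.apply_symm_apply, ContinuousLinearMap.comp_apply]
    refine h3.congr_fun fun l => ?_
    rw [map_smul, smul_eq_mul, mul_comm, ofTest_comm θ,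
      hΦ e _ _ (hj (translateTest l φ))]

end Frame

/-! ### Partial derivatives -/

/-- The partial derivative `∂_i` of Schwartz functions. -/
def partialTest (i : Fin n) : Test n →L[ℂ] Test n :=
  LineDeriv.lineDerivOpCLM ℂ (Test n) (EuclideanSpace.single i (1 : ℝ))

lemma partialTest_apply (i : Fin n) (φ : Test n) (t : V n) :
    partialTest i φ t = fderiv ℝ φ t (EuclideanSpace.single i 1) :=
  SchwartzMap.lineDerivOp_apply_eq_fderiv _ _ _

lemma partialDeriv_apply (i : Fin n) (f : Dist n) (φ : Test n) :
    partialDeriv i f φ = -f (partialTest i φ) := rfl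

lemma partialTest_comm (i j : Fin n) (φ : Test n) :
    partialTest i (partialTest j φ) = partialTest j (partialTest i φ) := by
  ext t
  have h : ∀ a b : Fin n, partialTest a (partialTest b φ) t =
      fderiv ℝ (fderiv ℝ φ) t (EuclideanSpace.single a 1) (EuclideanSpace.single b 1) := by
    intro a b
    rw [partialTest_apply]
    have h1 : (partialTest b φ : V n → ℂ) = fun s => fderiv ℝ φ s (EuclideanSpace.single b 1) :=
      funext fun s => partialTest_apply b φ s
    have h2 : DifferentiableAt ℝ (fderiv ℝ φ) t :=
      (((φ.smooth 2).fderiv_right (m := 1) le_rfl).differentiable one_ne_zero).differentiableAt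
    rw [h1, fderiv_clm_apply h2 (differentiableAt_const _)]
    simp
  rw [h, h]
  exact ((φ.smooth 2).contDiffAt.isSymmSndFDerivAt (by simp)) _ _

lemma commute_partialDeriv (i j : Fin n) : Commute (partialDeriv i) (partialDeriv j) := by
  refine LinearMap.ext fun f => ContinuousLinearMap.ext fun φ => ?_
  simp only [Module.End.mul_apply, partialDeriv_apply, partialTest_comm]

lemma prod_map_pow_add_single_of_notMem {i : Fin n} (α : Fin n → ℕ) {l : List (Fin n)}
    (hi : i ∉ l) : (l.map fun j => partialDeriv j ^ (α + Pi.single i 1 : Fin n → ℕ) j).prod =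
      (l.map fun j => partialDeriv j ^ α j).prod := by
  congr 1
  refine List.map_congr_left fun j hj => ?_
  have : j ≠ i := fun h => hi (h ▸ hj)
  simp [this]

/-- The extra factor is moved to the right end through the commuting factors that follow it. -/
lemma prod_map_pow_add_single {i : Fin n} (α : Fin n → ℕ) {l : List (Fin n)} (hl : l.Nodup)
    (hi : i ∈ l) : (l.map fun j => partialDeriv j ^ (α + Pi.single i 1 : Fin n → ℕ) j).prod =
      (l.map fun j => partialDeriv j ^ α j).prod * partialDeriv i := by
  induction l with
  | nil => simp at hi
  | cons j t ih =>
    rw [List.nodup_cons] at hl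
    rw [List.map_cons, List.prod_cons, List.map_cons, List.prod_cons]
    by_cases hij : j = i
    · subst hij
      have hc : Commute (partialDeriv j) (t.map fun k => partialDeriv k ^ α k).prod := by
        refine Commute.list_prod_right _ _ fun x hx => ?_
        obtain ⟨k, -, rfl⟩ := List.mem_map.1 hx
        exact (commute_partialDeriv j k).pow_right _
      rw [prod_map_pow_add_single_of_notMem α hl.1, mul_assoc, ← hc.eq, ← mul_assoc]
      simp [pow_succ]
    · have hit : i ∈ t := (List.mem_cons.1 hi).resolve_left (Ne.symm hij)
      rw [ih hl.2 hit, mul_assoc]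
      simp [hij]

lemma multiDeriv_add_single (α : Fin n → ℕ) (i : Fin n) :
    multiDeriv (α + Pi.single i 1) = multiDeriv α * partialDeriv i := by
  rw [multiDeriv, multiDeriv, List.ofFn_eq_map, List.ofFn_eq_map]
  exact prod_map_pow_add_single α (List.nodup_finRange n) (List.mem_finRange i)

lemma multiDeriv_zero : multiDeriv (0 : Fin n → ℕ) = 1 := by
  simp [multiDeriv]

/-- The product rule that trades frequency weights for derivatives, in the analysis and the
synthesis estimates alike. -/
lemma partialTest_timeFreqShift (i : Fin n) (x ξ : V n) (φ : Test n) :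
    partialTest i (timeFreqShift x ξ φ) =
      (2 * Real.pi * Complex.I * (ξ i : ℂ)) • timeFreqShift x ξ φ +
        timeFreqShift x ξ (partialTest i φ) := by
  ext t
  have h1 : (timeFreqShift x ξ φ : V n → ℂ) = fun s => character ξ s * φ (s - x) :=
    funext fun s => timeFreqShift_apply x ξ φ s
  have h2 : HasFDerivAt (fun s : V n => φ (s - x)) (fderiv ℝ φ (t - x)) t :=
    (hasFDerivAt_comp_sub x).2 (φ.hasFDerivAt (t - x))
  have h3 : HasFDerivAt (character ξ) (character ξ t •
      ((2 * Real.pi * Complex.I : ℂ) • (Complex.ofRealCLM ∘L innerSL ℝ ξ))) t := by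
    have h4 : HasFDerivAt (fun s : V n => ((inner ℝ ξ s : ℝ) : ℂ))
        (Complex.ofRealCLM ∘L innerSL ℝ ξ) t :=
      (Complex.ofRealCLM ∘L innerSL ℝ ξ).hasFDerivAt
    exact (h4.const_mul (2 * Real.pi * Complex.I)).cexp
  rw [partialTest_apply, h1, (h3.fun_mul h2).fderiv]
  simp only [add_apply, smul_apply, timeFreqShift_apply, partialTest_apply,
    smul_eq_mul, ContinuousLinearMap.comp_apply, innerSL_apply_apply, Complex.ofRealCLM_apply]
  rw [EuclideanSpace.inner_single_right]
  simp
  ring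

/-! ### The topology of `𝓓_E` -/

section TestSpace

variable {E : Type*} [NormedAddCommGroup E] [NormedSpace ℂ E] (X : DistSpace n E)

lemma TestSpace.withSeminorms : WithSeminorms (TestSpace.seminorms X) := ⟨rfl⟩

instance : IsTopologicalAddGroup (TestSpace X) := (TestSpace.withSeminorms X).topologicalAddGroup

lemma TestSpace.continuous_deriv (α : Fin n → ℕ) : Continuous (TestSpace.deriv X α) := by
  refine (TestSpace.withSeminorms X).continuous_normedSpace_rng E _ ⟨{∑ i, α i}, 1, ?_⟩
  rw [Finset.sup_singleton, one_smul]
  exact Finset.le_sup (f := fun α => (normSeminorm ℂ E).comp (TestSpace.deriv X α))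
    ((mem_multiIndices _ α).2 le_rfl)

variable {X}

lemma TestSpace.continuous_of_deriv {G : Type*} [AddCommGroup G] [Module ℂ G] [TopologicalSpace G]
    [IsTopologicalAddGroup G] (T : G →ₗ[ℂ] TestSpace X)
    (h : ∀ α, Continuous fun g => TestSpace.deriv X α (T g)) : Continuous T := by
  refine (TestSpace.withSeminorms X).continuous_of_continuous_comp T fun N => ?_
  have : ((TestSpace.seminorms X N).comp T : G → ℝ) =
      ((multiIndices n N).sup fun α =>
        ((normSeminorm ℂ E).comp (TestSpace.deriv X α)).comp T : Seminorm ℂ G) := by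
    funext g
    rw [Seminorm.comp_apply, TestSpace.seminorms, Seminorm.finset_sup_apply,
      Seminorm.finset_sup_apply]
    rfl
  rw [this]
  exact Seminorm.continuous_finsetSup fun α _ => (h α).norm

variable (X) in
/-- The partial derivative `∂_i` on `𝓓_E`. -/
def TestSpace.partialDeriv (i : Fin n) : TestSpace X →ₗ[ℂ] TestSpace X :=
  LinearMap.codRestrict (testSubmodule X) (Gabor.partialDeriv i ∘ₗ TestSpace.toDist X) fun f =>
    (mem_testSubmodule X _).2 fun α => by
      obtain ⟨e, he⟩ := (mem_testSubmodule X _).1 f.2 (α + Pi.single i 1)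
      exact ⟨e, by rw [he, multiDeriv_add_single]; rfl⟩

lemma TestSpace.toDist_partialDeriv (i : Fin n) (f : TestSpace X) :
    TestSpace.toDist X (TestSpace.partialDeriv X i f) =
      Gabor.partialDeriv i (TestSpace.toDist X f) := rfl

lemma TestSpace.deriv_partialDeriv (α : Fin n → ℕ) (i : Fin n) (f : TestSpace X) :
    TestSpace.deriv X α (TestSpace.partialDeriv X i f) =
      TestSpace.deriv X (α + Pi.single i 1) f := by
  refine X.injective_incl ?_
  rw [TestSpace.incl_deriv, TestSpace.incl_deriv, multiDeriv_add_single,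
    TestSpace.toDist_partialDeriv]
  rfl

lemma TestSpace.continuous_partialDeriv (i : Fin n) :
    Continuous (TestSpace.partialDeriv X i) := by
  refine TestSpace.continuous_of_deriv _ fun α => ?_
  simp only [TestSpace.deriv_partialDeriv]
  exact TestSpace.continuous_deriv X _

lemma TestSpace.incl_deriv_zero (f : TestSpace X) :
    X.incl (TestSpace.deriv X 0 f) = TestSpace.toDist X f := by
  rw [TestSpace.incl_deriv, multiDeriv_zero]
  rfl

end TestSpace

/-! ### The analysis operator -/

section Analysis

variable {E : Type*} [NormedAddCommGroup E] [NormedSpace ℂ E] {X : DistSpace n E}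

lemma IsSynth.add {Λ : Submodule ℤ (V n)} {χ : Test n} {c c' : Λ → ℂ} {e e' : E}
    (h : IsSynth X χ c e) (h' : IsSynth X χ c' e') :
    IsSynth X χ (fun l => c l + c' l) (e + e') := fun φ hφ => by
  simpa [add_mul] using (h φ hφ).add (h' φ hφ)

lemma IsSynth.smul {Λ : Submodule ℤ (V n)} {χ : Test n} {c : Λ → ℂ} {e : E}
    (h : IsSynth X χ c e) (a : ℂ) : IsSynth X χ (fun l => a * c l) (a • e) := fun φ hφ => by
  simpa [mul_assoc] using (h φ hφ).mul_left a

lemma norm_le_sum_norm_apply (ξ : V n) : ‖ξ‖ ≤ ∑ i, ‖ξ i‖ := by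
  have h := (EuclideanSpace.basisFun (Fin n) ℝ).sum_repr ξ
  conv_lhs => rw [← h]
  refine (norm_sum_le _ _).trans (Finset.sum_le_sum fun i _ => ?_)
  rw [norm_smul, (EuclideanSpace.basisFun (Fin n) ℝ).orthonormal.1 i, mul_one]
  rfl

/-- Integration by parts in the short-time Fourier transform. -/
lemma mul_apply_timeFreqShift (f : Dist n) (x ξ : V n) (φ : Test n) (i : Fin n) :
    2 * Real.pi * Complex.I * (ξ i : ℂ) * f (timeFreqShift x (-ξ) φ) =
      f (timeFreqShift x (-ξ) (partialTest i φ)) +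
        partialDeriv i f (timeFreqShift x (-ξ) φ) := by
  rw [partialDeriv_apply, partialTest_timeFreqShift, map_add, map_smul, PiLp.neg_apply, smul_eq_mul]
  push_cast
  ring

/-- Induction on `N`, over all windows and all `f` at once, because integration by parts changes
both. The loss `K` comes from one modulation and depends on neither `N` nor the window. -/
lemma exists_analysis_bound (hX : ShiftBounded X) {Λ : Submodule ℤ (V n)} (hF : FrameBounded X Λ)
    (χ : Test n) : ∃ K : ℕ, ∀ (N : ℕ) (φ : Test n), ∃ q : Seminorm ℂ (TestSpace X), Continuous q ∧
      ∀ (f : TestSpace X) (ξ : V n), ∃ e : E,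
        IsSynth X χ (fun l : Λ => TestSpace.toDist X f (timeFreqShift l (-ξ) φ)) e ∧
        (1 + ‖ξ‖) ^ N * ‖e‖ ≤ (1 + ‖ξ‖) ^ K * q f := by
  obtain ⟨C, K, hC, hM⟩ := hX.modulate
  refine ⟨K, fun N => ?_⟩
  induction N with
  | zero =>
    intro φ
    -- As `⟨f, M_{-ξ} T_λ φ⟩ = ⟨M_{-ξ} f, T_λ φ⟩`, the required element is the frame operator
    -- applied to `M_{-ξ} f`.
    obtain ⟨D, hD, hA⟩ := hF φ χ
    lift C to NNReal using hC
    lift D to NNReal using hD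
    refine ⟨(D * C) •
      (normSeminorm ℂ E).comp (TestSpace.deriv X 0),
      ((TestSpace.continuous_deriv X 0).norm).const_smul _, fun f ξ => ?_⟩
    obtain ⟨g, hg, hgb⟩ := hM (-ξ) (TestSpace.deriv X 0 f)
    obtain ⟨e, heb, he⟩ := hA g
    refine ⟨e, fun θ _ => ?_, ?_⟩
    · have h := he θ
      rw [hg, TestSpace.incl_deriv_zero] at h
      exact h
    · rw [pow_zero, one_mul]
      rw [norm_neg] at hgb
      calc ‖e‖ ≤ D * (C * (1 + ‖ξ‖) ^ K * ‖TestSpace.deriv X 0 f‖) := heb.trans (by gcongr)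
        _ = (1 + ‖ξ‖) ^ K * ((D * C) * ‖TestSpace.deriv X 0 f‖) := by ring
        _ = _ := rfl
  | succ N ih =>
    intro φ
    obtain ⟨q, hq, hqb⟩ := ih φ
    choose r hr hrb using fun i => ih (partialTest i φ)
    refine ⟨q + ∑ i, (r i + q.comp (TestSpace.partialDeriv X i)), ?_, fun f ξ => ?_⟩
    · have : (⇑(q + ∑ i, (r i + q.comp (TestSpace.partialDeriv X i))) : TestSpace X → ℝ) =
          fun f => q f + ∑ i, (r i f + q (TestSpace.partialDeriv X i f)) := by
        funext f
        simp [sum_apply]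
      rw [this]
      exact hq.add (continuous_finsetSum _ fun i _ =>
        (hr i).add (hq.comp (TestSpace.continuous_partialDeriv i)))
    · obtain ⟨e, he, heb⟩ := hqb f ξ
      refine ⟨e, he, ?_⟩
      have hi : ∀ i, (1 + ‖ξ‖) ^ N * (‖ξ i‖ * ‖e‖) ≤
          (1 + ‖ξ‖) ^ K * (r i f + q (TestSpace.partialDeriv X i f)) := by
        intro i
        obtain ⟨e₁, he₁, hb₁⟩ := hrb i f ξ
        obtain ⟨e₂, he₂, hb₂⟩ := hqb (TestSpace.partialDeriv X i f) ξ
        have h1 : (2 * Real.pi * Complex.I * (ξ i : ℂ)) • e = e₁ + e₂ := by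
          refine IsSynth.unique (he.smul _) ?_
          convert! he₁.add he₂ using 2 with l
          rw [mul_apply_timeFreqShift, TestSpace.toDist_partialDeriv]
        have h2 : ‖ξ i‖ * ‖e‖ ≤ ‖e₁‖ + ‖e₂‖ := by
          refine le_trans ?_ (norm_add_le e₁ e₂)
          rw [← h1, norm_smul]
          gcongr
          simp only [norm_mul, Complex.norm_I, Complex.norm_real, mul_one, Complex.norm_ofNat,
            Real.norm_of_nonneg Real.pi_pos.le]
          -- The factor `2π` is at least `1` and can be dropped.
          refine le_mul_of_one_le_left (abs_nonneg _) ?_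
          linarith [Real.pi_gt_three]
        calc _ ≤ (1 + ‖ξ‖) ^ N * (‖e₁‖ + ‖e₂‖) := by gcongr
          _ ≤ _ := by rw [mul_add, mul_add]; exact add_le_add hb₁ hb₂
      have h3 : 1 + ‖ξ‖ ≤ 1 + ∑ i, ‖ξ i‖ := by linarith [norm_le_sum_norm_apply ξ]
      calc (1 + ‖ξ‖) ^ (N + 1) * ‖e‖ = (1 + ‖ξ‖) ^ N * ‖e‖ * (1 + ‖ξ‖) := by ring
        _ ≤ (1 + ‖ξ‖) ^ N * ‖e‖ * (1 + ∑ i, ‖ξ i‖) := by gcongr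
        _ = (1 + ‖ξ‖) ^ N * ‖e‖ + ∑ i, (1 + ‖ξ‖) ^ N * (‖ξ i‖ * ‖e‖) := by
          rw [mul_add, mul_one, Finset.mul_sum]
          congr 1
          exact Finset.sum_congr rfl fun i _ => by ring
        _ ≤ (1 + ‖ξ‖) ^ K * q f +
            ∑ i, (1 + ‖ξ‖) ^ K * (r i f + q (TestSpace.partialDeriv X i f)) := by
          exact add_le_add heb (Finset.sum_le_sum fun i _ => hi i)
        _ = _ := by
          rw [← Finset.mul_sum, ← mul_add]
          simp [sum_apply]

lemma DiscreteSpace.norm_eq {Λ : Submodule ℤ (V n)} {χ : Test n} {c : DiscreteSpace X Λ χ} {e : E}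
    (h : IsSynth X χ (DiscreteSpace.coeff X Λ χ c) e) : ‖c‖ = ‖e‖ := by
  rw [DiscreteSpace.norm_def, (DiscreteSpace.isSynth X Λ χ c).unique h]

lemma RapidSpace.withSeminorms (Λ : Submodule ℤ (V n)) (B : Type*) [SeminormedAddCommGroup B]
    [NormedSpace ℂ B] : WithSeminorms (RapidSpace.seminorms Λ B) := ⟨rfl⟩

instance (Λ : Submodule ℤ (V n)) (B : Type*) [SeminormedAddCommGroup B] [NormedSpace ℂ B] :
    IsTopologicalAddGroup (RapidSpace Λ B) := (RapidSpace.withSeminorms Λ B).topologicalAddGroup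

theorem exists_analysisOperator (hX : ShiftBounded X) {Λ₀ : Submodule ℤ (V n)}
    (hF : FrameBounded X Λ₀) (Λ₁ : Submodule ℤ (V n)) (χ ψ : Test n) :
    ∃ C : TestSpace X →L[ℂ] RapidSpace Λ₁ (DiscreteSpace X Λ₀ χ),
      ∀ (f : TestSpace X) (l₀ : Λ₀) (l₁ : Λ₁),
        DiscreteSpace.coeff X Λ₀ χ (RapidSpace.coeff Λ₁ _ (C f) l₁) l₀ =
          stft ψ (TestSpace.toDist X f) l₀ l₁ := by
  obtain ⟨K, hK⟩ := exists_analysis_bound hX hF χ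
  -- The additional `K` powers absorb the modulation growth on the right side.
  choose q hq hqb using fun N => hK (N + K) (conjTest ψ)
  let c : TestSpace X → Λ₁ → DiscreteSpace X Λ₀ χ := fun f l₁ =>
    (⟨fun l₀ => stft ψ (TestSpace.toDist X f) l₀ l₁,
      (hqb 0 f l₁).imp fun _ h => h.1⟩ : discreteSubmodule X Λ₀ χ)
  have hc : ∀ N f l₁, ‖c f l₁‖ * (1 + ‖(l₁ : V n)‖) ^ N ≤ q N f := by
    intro N f l₁
    obtain ⟨e, he, heb⟩ := hqb N f l₁
    rw [DiscreteSpace.norm_eq (c := c f l₁) he]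
    rw [pow_add, mul_comm (_ ^ N), mul_assoc] at heb
    have := le_of_mul_le_mul_left heb (by positivity)
    rwa [mul_comm]
  let C : TestSpace X →ₗ[ℂ] RapidSpace Λ₁ (DiscreteSpace X Λ₀ χ) :=
    { toFun := fun f => (⟨c f, fun N => ⟨q N f, by
        rintro _ ⟨l, rfl⟩
        exact hc N f l⟩⟩ : rapidSubmodule Λ₁ (DiscreteSpace X Λ₀ χ))
      map_add' := fun f g => Subtype.ext (funext fun l₁ => Subtype.ext (funext fun l₀ => by
        change stft ψ (TestSpace.toDist X (f + g)) l₀ l₁ = _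
        rw [map_add]
        rfl))
      map_smul' := fun a f => Subtype.ext (funext fun l₁ => Subtype.ext (funext fun l₀ => by
        change stft ψ (TestSpace.toDist X (a • f)) l₀ l₁ = _
        rw [map_smul]
        rfl)) }
  refine ⟨⟨C, (RapidSpace.withSeminorms Λ₁ _).continuous_of_continuous_comp C fun N => ?_⟩,
    fun f l₀ l₁ => rfl⟩
  refine Seminorm.continuous_of_le (hq N) fun f => ?_
  exact ciSup_le fun l₁ => hc N f l₁

end Analysis

/-! ### Summation in the strong dual of the Schwartz space -/

lemma exists_le_of_isVonNBounded {p : Seminorm ℂ (Test n)} (hp : Continuous p)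
    {B : Set (Test n)} (hB : Bornology.IsVonNBounded ℂ B) : ∃ R : ℝ, ∀ φ ∈ B, p φ ≤ R := by
  have h1 : p.ball 0 1 ∈ 𝓝 (0 : Test n) := by
    have h2 : {φ | p φ < 1} ∈ 𝓝 (0 : Test n) :=
      hp.continuousAt.eventually_lt_const (by simp)
    simpa [Seminorm.ball_zero_eq] using h2
  obtain ⟨r, hr⟩ := (hB h1).exists_pos
  obtain ⟨hr0, hr⟩ := hr
  refine ⟨r, fun φ hφ => ?_⟩
  have h3 := hr (r : ℂ) (by simp [abs_of_pos hr0]) hφ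
  obtain ⟨ψ, hψ, rfl⟩ := h3
  rw [Seminorm.mem_ball_zero] at hψ
  simp only [map_smul_eq_mul, Complex.norm_real, Real.norm_of_nonneg hr0.le]
  nlinarith

/-- Weierstrass M-test on each bounded set of test functions, which is convergence in the strong
topology. -/
lemma hasSum_dist {ι : Type*} {T : ι → Dist n} {f : Dist n}
    (hf : ∀ φ, HasSum (fun i => T i φ) (f φ))
    (hb : ∀ B : Set (Test n), Bornology.IsVonNBounded ℂ B →
      ∃ u : ι → ℝ, Summable u ∧ ∀ i, ∀ φ ∈ B, ‖T i φ‖ ≤ u i) : HasSum T f := by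
  rw [HasSum, SummationFilter.unconditional_filter]
  refine (UniformConvergenceCLM.tendsto_iff_tendstoUniformlyOn (σ := RingHom.id ℂ) (F := ℂ)
    {B : Set (Test n) | Bornology.IsVonNBounded ℂ B}).2 fun B hB => ?_
  obtain ⟨u, hu, hub⟩ := hb B hB
  refine ((tendstoUniformlyOn_tsum hu hub).congr_right fun φ _ => (hf φ).tsum_eq).congr
    (.of_forall fun s φ _ => ?_)
  exact (sum_apply s T φ).symm

/-! ### The synthesis operator -/

section Synthesis

variable {E : Type*} [NormedAddCommGroup E] [NormedSpace ℂ E] {X : DistSpace n E}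
variable {Λ₀ Λ₁ : Submodule ℤ (V n)} {χ : Test n}

/-- The translates of `χ` by distinct lattice points have disjoint supports. -/
def DisjointTranslates (Λ : Submodule ℤ (V n)) (χ : Test n) : Prop :=
  ∀ (l m : Λ) (t : V n), χ (t - l) ≠ 0 → χ (t - m) ≠ 0 → l = m

/-- The pairing is `∫ |χ|²`, and `χ` is continuous. -/
lemma ofTest_conjTest_ne_zero (hχ : χ ≠ 0) : ofTest χ (conjTest χ) ≠ 0 := by
  have h1 : ofTest χ (conjTest χ) = ((∫ t, ‖χ t‖ ^ 2 : ℝ) : ℂ) := by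
    rw [ofTest_apply, ← integral_complex_ofReal]
    refine integral_congr_ae (.of_forall fun t => ?_)
    simp only [conjTest_apply, Complex.mul_conj, Complex.normSq_eq_norm_sq]
  rw [h1, Complex.ofReal_ne_zero]
  have h2 : Integrable fun t => ‖χ t‖ ^ 2 := by
    have h3 := (mulTest χ (conjTest χ)).integrable (μ := volume)
    refine h3.norm.congr (.of_forall fun t => ?_)
    simp [conjTest_apply, sq]
  have h4 : Continuous fun t => ‖χ t‖ ^ 2 := χ.continuous.norm.pow 2
  intro h0
  rw [integral_eq_zero_iff_of_nonneg (fun t => by positivity) h2] at h0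
  have h5 := (h4.ae_eq_iff_eq volume continuous_const).1 h0
  refine hχ (SchwartzMap.ext fun t => ?_)
  have h6 : ‖χ t‖ ^ 2 = 0 := congrFun h5 t
  simpa using h6

lemma hasCompactSupport_translate_conj (hχ : HasCompactSupport χ) (x : V n) :
    HasCompactSupport (translateTest x (conjTest χ)) := by
  have h1 : HasCompactSupport fun t => (starRingEnd ℂ) (χ t) :=
    hχ.comp_left (g := (starRingEnd ℂ)) (map_zero _)
  exact h1.comp_homeomorph (Homeomorph.subRight x)

/-- The coefficients are recovered from the synthesis by testing against translates of `χ`. -/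
lemma IsSynth.apply_translate (hχ : HasCompactSupport χ) (hd : DisjointTranslates Λ₀ χ)
    {c : Λ₀ → ℂ} {e : E} (h : IsSynth X χ c e) (l : Λ₀) :
    X.incl e (translateTest l (conjTest χ)) = c l * ofTest χ (conjTest χ) := by
  have h1 := h _ (hasCompactSupport_translate_conj hχ l)
  refine h1.unique ?_
  have h2 : ofTest χ (conjTest χ) =
      ofTest (translateTest (l : V n) χ) (translateTest (l : V n) (conjTest χ)) := by
    rw [ofTest_apply, ofTest_apply, ← integral_sub_right_eq_self _ (l : V n)]
    rfl
  rw [h2]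
  refine hasSum_single l fun m hm => ?_
  rw [ofTest_apply, integral_eq_zero_of_ae, mul_zero]
  refine .of_forall fun t => ?_
  simp only [translateTest_apply, conjTest_apply, Pi.zero_apply, mul_eq_zero, map_eq_zero]
  by_contra! hne
  exact hm (hd m l t hne.1 hne.2)

lemma RapidSpace.norm_coeff_le (Λ : Submodule ℤ (V n)) {B : Type*} [SeminormedAddCommGroup B]
    [NormedSpace ℂ B] (N : ℕ) (c : RapidSpace Λ B) (l : Λ) :
    ‖RapidSpace.coeff Λ B c l‖ ≤ RapidSpace.seminorms Λ B N c * ((1 + ‖(l : V n)‖) ^ N)⁻¹ := by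
  rw [← div_eq_mul_inv, le_div_iff₀ (by positivity)]
  exact le_ciSup (c.2 N) l

lemma RapidSpace.seminorms_mono (Λ : Submodule ℤ (V n)) {B : Type*} [SeminormedAddCommGroup B]
    [NormedSpace ℂ B] {N M : ℕ} (h : N ≤ M) (c : RapidSpace Λ B) :
    RapidSpace.seminorms Λ B N c ≤ RapidSpace.seminorms Λ B M c := by
  refine ciSup_le fun l => ?_
  refine le_trans ?_ (le_ciSup (c.2 M) l)
  exact mul_le_mul_of_nonneg_left
    (pow_le_pow_right₀ (by linarith [norm_nonneg (l : V n)]) h) (norm_nonneg _)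

/-- The coordinate multiplication `c ↦ (a λ_i c_λ)` on rapidly decreasing families. -/
def RapidSpace.mulCoord {Λ : Submodule ℤ (V n)} {B : Type*} [SeminormedAddCommGroup B]
    [NormedSpace ℂ B] (a : ℂ) (i : Fin n) (c : RapidSpace Λ B) : RapidSpace Λ B :=
  (⟨fun l => (a * ((l : V n) i : ℂ)) • RapidSpace.coeff Λ B c l, fun N => by
    refine ⟨‖a‖ * RapidSpace.seminorms Λ B (N + 1) c, ?_⟩
    rintro _ ⟨l, rfl⟩
    have h1 : ‖((l : V n) i : ℂ)‖ ≤ 1 + ‖(l : V n)‖ := by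
      rw [Complex.norm_real]
      linarith [PiLp.norm_apply_le (l : V n) i]
    have h2 : ‖RapidSpace.coeff Λ B c l‖ * (1 + ‖(l : V n)‖) ^ (N + 1) ≤
      RapidSpace.seminorms Λ B (N + 1) c := le_ciSup (c.2 (N + 1)) l
    simp only [norm_smul, norm_mul]
    calc _ ≤ ‖a‖ * (1 + ‖(l : V n)‖) * ‖RapidSpace.coeff Λ B c l‖ * (1 + ‖(l : V n)‖) ^ N := by
          gcongr
      _ = ‖a‖ * (‖RapidSpace.coeff Λ B c l‖ * (1 + ‖(l : V n)‖) ^ (N + 1)) := by ring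
      _ ≤ _ := by gcongr⟩ : rapidSubmodule Λ B)

lemma RapidSpace.coeff_mulCoord {Λ : Submodule ℤ (V n)} {B : Type*} [SeminormedAddCommGroup B]
    [NormedSpace ℂ B] (a : ℂ) (i : Fin n) (c : RapidSpace Λ B) (l : Λ) :
    RapidSpace.coeff Λ B (RapidSpace.mulCoord a i c) l =
      (a * ((l : V n) i : ℂ)) • RapidSpace.coeff Λ B c l := rfl

lemma RapidSpace.seminorms_mulCoord_le {Λ : Submodule ℤ (V n)} {B : Type*}
    [SeminormedAddCommGroup B] [NormedSpace ℂ B] (a : ℂ) (i : Fin n) (N : ℕ) (c : RapidSpace Λ B) :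
    RapidSpace.seminorms Λ B N (RapidSpace.mulCoord a i c) ≤
      ‖a‖ * RapidSpace.seminorms Λ B (N + 1) c := by
  refine ciSup_le fun l => ?_
  have h1 : ‖((l : V n) i : ℂ)‖ ≤ 1 + ‖(l : V n)‖ := by
    rw [Complex.norm_real]
    linarith [PiLp.norm_apply_le (l : V n) i]
  have h2 : ‖RapidSpace.coeff Λ B c l‖ * (1 + ‖(l : V n)‖) ^ (N + 1) ≤
    RapidSpace.seminorms Λ B (N + 1) c := le_ciSup (c.2 (N + 1)) l
  rw [RapidSpace.coeff_mulCoord, norm_smul, norm_mul]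
  calc _ ≤ ‖a‖ * (1 + ‖(l : V n)‖) * ‖RapidSpace.coeff Λ B c l‖ * (1 + ‖(l : V n)‖) ^ N := by
        gcongr
    _ = ‖a‖ * (‖RapidSpace.coeff Λ B c l‖ * (1 + ‖(l : V n)‖) ^ (N + 1)) := by ring
    _ ≤ _ := by gcongr

/-- The entries `c_{λ₀, λ₁}` of an element of `s(Λ₁; E_d(Λ₀))`. -/
def entry (c : RapidSpace Λ₁ (DiscreteSpace X Λ₀ χ)) (l : Λ₀ × Λ₁) : ℂ :=
  DiscreteSpace.coeff X Λ₀ χ (RapidSpace.coeff Λ₁ _ c l.2) l.1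

/-- `f` is the weak sum of the Gabor series with coefficients `c` and window `ψ`. -/
def IsGaborSum (ψ : Test n) (c : RapidSpace Λ₁ (DiscreteSpace X Λ₀ χ)) (f : Dist n) : Prop :=
  ∀ θ : Test n, HasSum (fun l : Λ₀ × Λ₁ =>
    entry c l * ofTest (timeFreqShift (l.1 : V n) l.2 ψ) θ) (f θ)

lemma IsGaborSum.unique {ψ : Test n} {c : RapidSpace Λ₁ (DiscreteSpace X Λ₀ χ)} {f g : Dist n}
    (hf : IsGaborSum ψ c f) (hg : IsGaborSum ψ c g) : f = g :=
  ContinuousLinearMap.ext fun θ => (hf θ).unique (hg θ)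

/-- Coefficient recovery by translates of `χ̄` gives polynomial growth in `λ₀`; rapid decay in `λ₁`
is built into the space. -/
lemma exists_norm_entry_le (hX : ShiftBounded X) (hχ : HasCompactSupport χ) (hχ0 : χ ≠ 0)
    (hd : DisjointTranslates Λ₀ χ) : ∃ (C : ℝ) (K : ℕ), 0 ≤ C ∧ ∀ (N : ℕ)
      (c : RapidSpace Λ₁ (DiscreteSpace X Λ₀ χ)) (l : Λ₀ × Λ₁), ‖entry c l‖ ≤
        C * (1 + ‖(l.1 : V n)‖) ^ K * (RapidSpace.seminorms Λ₁ _ N c *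
          ((1 + ‖(l.2 : V n)‖) ^ N)⁻¹) := by
  obtain ⟨C, K, hC, h⟩ := hX.exists_norm_incl_translateTest_le (conjTest χ)
  set I := ofTest χ (conjTest χ)
  have hI : I ≠ 0 := ofTest_conjTest_ne_zero hχ0
  refine ⟨C * ‖I‖⁻¹, K, by positivity, fun N c l => ?_⟩
  have h1 := (DiscreteSpace.isSynth X Λ₀ χ (RapidSpace.coeff Λ₁ _ c l.2)).apply_translate hχ hd l.1
  have h2 := h l.1 (DiscreteSpace.synth X Λ₀ χ (RapidSpace.coeff Λ₁ _ c l.2))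
  rw [h1, norm_mul, ← DiscreteSpace.norm_def] at h2
  have h3 := RapidSpace.norm_coeff_le Λ₁ N c l.2
  have hI' : 0 < ‖I‖ := norm_pos_iff.2 hI
  calc ‖entry c l‖ = (‖entry c l‖ * ‖I‖) * ‖I‖⁻¹ := by field_simp
    _ ≤ (C * (1 + ‖(l.1 : V n)‖) ^ K * ‖RapidSpace.coeff Λ₁ _ c l.2‖) * ‖I‖⁻¹ := by
      exact mul_le_mul_of_nonneg_right h2 (by positivity)
    _ ≤ (C * (1 + ‖(l.1 : V n)‖) ^ K * (RapidSpace.seminorms Λ₁ _ N c *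
          ((1 + ‖(l.2 : V n)‖) ^ N)⁻¹)) * ‖I‖⁻¹ := by gcongr
    _ = _ := by ring

/-- Characters have modulus one, so the `L¹` bound on `θ · T_x ψ` is uniform in `ξ`. -/
lemma exists_norm_ofTest_timeFreqShift_le (ψ : Test n) (N : ℕ) :
    ∃ p : Seminorm ℂ (Test n), Continuous p ∧ ∀ (x ξ : V n) (θ : Test n),
      ‖ofTest (timeFreqShift x ξ ψ) θ‖ ≤ p θ * ((1 + ‖x‖) ^ N)⁻¹ := by
  obtain ⟨p, hp, h⟩ := exists_norm_mulTest_translateTest_le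
    (SchwartzMap.toLpCLM ℂ ℂ 1 (volume : Measure (V n))) N
  obtain ⟨a, ha⟩ : ∃ a : NNReal, (a : ℝ) = p ψ := ⟨⟨p ψ, apply_nonneg _ _⟩, rfl⟩
  refine ⟨a • p, hp.const_smul _, fun x ξ θ => ?_⟩
  have h1 := h θ ψ x
  rw [SchwartzMap.toLpCLM_apply, SchwartzMap.norm_toLp_one] at h1
  rw [← div_eq_mul_inv, le_div_iff₀' (by positivity)]
  refine le_trans ?_ (h1.trans_eq ((mul_comm _ _).trans (by rw [← ha]; rfl)))
  gcongr
  rw [ofTest_apply]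
  refine (norm_integral_le_integral_norm _).trans_eq (integral_congr_ae (.of_forall fun t => ?_))
  simp only [timeFreqShift_apply, mulTest_apply, translateTest_apply, norm_mul, norm_character]
  ring

/-- Termwise differentiation: a derivative falls either on the character or on the window. -/
lemma isGaborSum_partialDeriv {ψ : Test n} {c : RapidSpace Λ₁ (DiscreteSpace X Λ₀ χ)}
    {f f₁ f₂ : Dist n} (i : Fin n) (hf : IsGaborSum ψ c f)
    (h₁ : IsGaborSum ψ (RapidSpace.mulCoord (2 * Real.pi * Complex.I) i c) f₁)
    (h₂ : IsGaborSum (partialTest i ψ) c f₂) : partialDeriv i f = f₁ + f₂ := by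
  refine ContinuousLinearMap.ext fun θ => ?_
  have h3 := (hf (partialTest i θ)).neg
  have h4 := (h₁ θ).add (h₂ θ)
  rw [partialDeriv_apply, add_apply]
  refine h3.unique (h4.congr_fun fun l => ?_)
  have h5 : ofTest (timeFreqShift (l.1 : V n) l.2 ψ) (partialTest i θ) =
      -ofTest (partialTest i (timeFreqShift (l.1 : V n) l.2 ψ)) θ :=
    SchwartzMap.integral_mul_lineDerivOp_right_eq_neg_left _ _ _
  have h6 : entry (RapidSpace.mulCoord (2 * Real.pi * Complex.I) i c) l =
      (2 * Real.pi * Complex.I * ((l.2 : V n) i : ℂ)) * entry c l := by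
    rw [entry, RapidSpace.coeff_mulCoord, map_smul]
    rfl
  have h7 : ofTest (partialTest i (timeFreqShift (l.1 : V n) l.2 ψ)) θ =
      (2 * Real.pi * Complex.I * ((l.2 : V n) i : ℂ)) *
        ofTest (timeFreqShift (l.1 : V n) l.2 ψ) θ +
      ofTest (timeFreqShift (l.1 : V n) l.2 (partialTest i ψ)) θ := by
    rw [partialTest_timeFreqShift, ofTest_comm, map_add, map_smul, smul_eq_mul, ofTest_comm θ,
      ofTest_comm θ]
  rw [h5, h6, h7]
  ring

variable [DiscreteTopology Λ₀] [IsZLattice ℝ Λ₀] [DiscreteTopology Λ₁] [IsZLattice ℝ Λ₁]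

/-- The Gabor series is dominated, uniformly on bounded sets of test functions. -/
lemma exists_gabor_bound (hX : ShiftBounded X) (hχ : HasCompactSupport χ) (hχ0 : χ ≠ 0)
    (hd : DisjointTranslates Λ₀ χ) (ψ : Test n) : ∃ p : Seminorm ℂ (Test n), Continuous p ∧
      ∀ c : RapidSpace Λ₁ (DiscreteSpace X Λ₀ χ), ∃ u : Λ₀ × Λ₁ → ℝ, Summable u ∧
        ∀ l θ, ‖entry c l * ofTest (timeFreqShift (l.1 : V n) l.2 ψ) θ‖ ≤ u l * p θ := by
  obtain ⟨C, K, hC, h⟩ := exists_norm_entry_le (Λ₁ := Λ₁) hX hχ hχ0 hd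
  obtain ⟨p, hp, h'⟩ := exists_norm_ofTest_timeFreqShift_le ψ (K + (n + 1))
  refine ⟨p, hp, fun c => ⟨fun l => C * RapidSpace.seminorms Λ₁ _ (n + 1) c *
    (((1 + ‖(l.1 : V n)‖) ^ (n + 1))⁻¹ * ((1 + ‖(l.2 : V n)‖) ^ (n + 1))⁻¹), ?_, fun l θ => ?_⟩⟩
  · exact ((summable_one_add_norm_pow_inv Λ₀ (Nat.lt_succ_self n)).mul_of_nonneg
      (summable_one_add_norm_pow_inv Λ₁ (Nat.lt_succ_self n)) (fun _ => by positivity)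
      (fun _ => by positivity)).mul_left _
  · rw [norm_mul]
    calc _ ≤ (C * (1 + ‖(l.1 : V n)‖) ^ K * (RapidSpace.seminorms Λ₁ _ (n + 1) c *
          ((1 + ‖(l.2 : V n)‖) ^ (n + 1))⁻¹)) *
            (p θ * ((1 + ‖(l.1 : V n)‖) ^ (K + (n + 1)))⁻¹) := by
          gcongr
          · exact h (n + 1) c l
          · exact h' _ _ _
      _ = _ := by
        have : (1 + ‖(l.1 : V n)‖) ^ K ≠ 0 := by positivity
        rw [pow_add _ K]
        field_simp

lemma IsGaborSum.hasSum (hX : ShiftBounded X) (hχ : HasCompactSupport χ) (hχ0 : χ ≠ 0)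
    (hd : DisjointTranslates Λ₀ χ) {ψ : Test n} {c : RapidSpace Λ₁ (DiscreteSpace X Λ₀ χ)}
    {f : Dist n} (hf : IsGaborSum ψ c f) :
    HasSum (fun l : Λ₀ × Λ₁ => entry c l • ofTest (timeFreqShift (l.1 : V n) l.2 ψ)) f := by
  obtain ⟨p, hp, h⟩ := exists_gabor_bound (Λ₁ := Λ₁) hX hχ hχ0 hd ψ
  obtain ⟨u, hu, hb⟩ := h c
  refine hasSum_dist hf fun B hB => ?_
  obtain ⟨R, hR⟩ := exists_le_of_isVonNBounded hp hB
  refine ⟨fun l => |u l| * |R|, hu.abs.mul_right _, fun l φ hφ => (hb l φ).trans ?_⟩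
  have h1 : 0 ≤ p φ := apply_nonneg _ _
  exact mul_le_mul (le_abs_self _) ((hR φ hφ).trans (le_abs_self R)) h1 (abs_nonneg _)

/-- The Gabor series has a sum in `E`. -/
lemma exists_gaborSum [CompleteSpace E] (hX : ShiftBounded X) (hF : FrameBounded X Λ₀)
    (hχ : HasCompactSupport χ) (hχ0 : χ ≠ 0) (hd : DisjointTranslates Λ₀ χ) (ψ : Test n) :
    ∃ (C : ℝ) (N : ℕ), 0 ≤ C ∧ ∀ c : RapidSpace Λ₁ (DiscreteSpace X Λ₀ χ), ∃ d : E,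
      ‖d‖ ≤ C * RapidSpace.seminorms Λ₁ _ N c ∧ IsGaborSum ψ c (X.incl d) := by
  obtain ⟨C, K, hC, hM⟩ := hX.modulate
  -- Analysing `S_χ(c)` with `χ̄` returns the coefficients up to the factor `I = ‖χ‖₂²`; hence the
  -- scalar `I⁻¹` below.
  obtain ⟨D, hD, hA⟩ := hF (conjTest χ) ψ
  obtain ⟨p, -, hp⟩ := exists_gabor_bound (Λ₁ := Λ₁) hX hχ hχ0 hd ψ
  set I := ofTest χ (conjTest χ)
  have hI : I ≠ 0 := ofTest_conjTest_ne_zero hχ0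
  have hs := summable_one_add_norm_pow_inv Λ₁ (Nat.lt_succ_self n)
  refine ⟨C * (‖I⁻¹‖ * D) * ∑' l : Λ₁, ((1 + ‖(l : V n)‖) ^ (n + 1))⁻¹, K + (n + 1),
    by positivity, fun c => ?_⟩
  have h1 : ∀ l₁ : Λ₁, ∃ e : E, ‖e‖ ≤ C * (‖I⁻¹‖ * D) *
      RapidSpace.seminorms Λ₁ _ (K + (n + 1)) c * ((1 + ‖(l₁ : V n)‖) ^ (n + 1))⁻¹ ∧
      ∀ θ, HasSum (fun l₀ : Λ₀ => entry c (l₀, l₁) *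
        ofTest (timeFreqShift (l₀ : V n) l₁ ψ) θ) (X.incl e θ) := by
    intro l₁
    have hsy := DiscreteSpace.isSynth X Λ₀ χ (RapidSpace.coeff Λ₁ _ c l₁)
    obtain ⟨e, heb, he⟩ := hA (DiscreteSpace.synth X Λ₀ χ (RapidSpace.coeff Λ₁ _ c l₁))
    obtain ⟨e', he', heb'⟩ := hM l₁ (I⁻¹ • e)
    refine ⟨e', ?_, fun θ => ?_⟩
    · rw [← DiscreteSpace.norm_def] at heb
      have h2 := RapidSpace.norm_coeff_le Λ₁ (K + (n + 1)) c l₁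
      rw [norm_smul] at heb'
      calc ‖e'‖ ≤ C * (1 + ‖(l₁ : V n)‖) ^ K * (‖I⁻¹‖ * (D *
            (RapidSpace.seminorms Λ₁ _ (K + (n + 1)) c *
              ((1 + ‖(l₁ : V n)‖) ^ (K + (n + 1)))⁻¹))) := by
            refine heb'.trans ?_
            gcongr
            exact heb.trans (by gcongr)
        _ = _ := by
          have : (1 + ‖(l₁ : V n)‖) ^ K ≠ 0 := by positivity
          rw [pow_add]
          field_simp
    · have h2 := (he (modulateTest l₁ θ)).mul_left I⁻¹
      have h3 : X.incl e' θ = I⁻¹ * X.incl e (modulateTest l₁ θ) := by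
        rw [he', map_smul]
        rfl
      rw [h3]
      refine h2.congr_fun fun l₀ => ?_
      rw [hsy.apply_translate hχ hd l₀, timeFreqShift, ← modulate_ofTest]
      change _ = I⁻¹ * (entry c (l₀, l₁) * I * ofTest (translateTest (l₀ : V n) ψ)
        (modulateTest l₁ θ))
      rw [mul_comm (entry _ _) I, mul_assoc I, inv_mul_cancel_left₀ hI]
      rfl
  choose e heb he using h1
  have hsum := hs.mul_left (C * (‖I⁻¹‖ * D) * RapidSpace.seminorms Λ₁ _ (K + (n + 1)) c)
  refine ⟨∑' l, e l, ?_, fun θ => ?_⟩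
  · refine (tsum_of_norm_bounded hsum.hasSum heb).trans_eq ?_
    rw [tsum_mul_left]
    ring
  · obtain ⟨u, hu, hb⟩ := hp c
    have h2 : Summable fun l : Λ₀ × Λ₁ =>
        entry c l * ofTest (timeFreqShift (l.1 : V n) l.2 ψ) θ :=
      Summable.of_norm_bounded (hu.mul_right (p θ)) fun l => hb l θ
    have h3 := (X.eval θ).hasSum (Summable.of_norm_bounded hsum heb).hasSum
    have h4 : HasSum (fun l : Λ₁ × Λ₀ => entry c (l.2, l.1) *
        ofTest (timeFreqShift (l.2 : V n) l.1 ψ) θ) _ :=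
      (Equiv.prodComm Λ₁ Λ₀).hasSum_iff.2 h2.hasSum
    -- The double series converges absolutely, so its sum is the iterated one: first over `λ₀`, then
    -- over `λ₁`, where the series converges in `E`.
    have h5 := h4.prod_fiberwise fun l₁ => he l₁ θ
    have h6 := h5.unique h3
    change HasSum _ (X.eval θ (∑' l, e l))
    rw [← h6]
    exact h2.hasSum

/-- All derivatives of a Gabor sum belong to `E`. -/
lemma exists_multiDeriv_gaborSum [CompleteSpace E] (hX : ShiftBounded X) (hF : FrameBounded X Λ₀)
    (hχ : HasCompactSupport χ) (hχ0 : χ ≠ 0) (hd : DisjointTranslates Λ₀ χ) (k : ℕ) :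
    ∀ α : Fin n → ℕ, ∑ i, α i = k → ∀ ψ : Test n, ∃ (C : ℝ) (N : ℕ), 0 ≤ C ∧
      ∀ (c : RapidSpace Λ₁ (DiscreteSpace X Λ₀ χ)) (f : Dist n), IsGaborSum ψ c f →
        ∃ e : E, X.incl e = multiDeriv α f ∧ ‖e‖ ≤ C * RapidSpace.seminorms Λ₁ _ N c := by
  induction k with
  | zero =>
    intro α hα ψ
    have h0 : α = 0 := funext fun i => (Finset.sum_eq_zero_iff.1 hα) i (Finset.mem_univ i)
    obtain ⟨C, N, hC, h⟩ := exists_gaborSum (Λ₁ := Λ₁) hX hF hχ hχ0 hd ψ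
    refine ⟨C, N, hC, fun c f hf => ?_⟩
    obtain ⟨d, hdb, hdf⟩ := h c
    refine ⟨d, ?_, hdb⟩
    rw [h0, multiDeriv_zero, hdf.unique hf]
    rfl
  | succ k ih =>
    intro α hα ψ
    obtain ⟨i, hi⟩ : ∃ i, α i ≠ 0 := by
      by_contra! h
      simp [h] at hα
    obtain ⟨β, rfl⟩ : ∃ β : Fin n → ℕ, α = β + Pi.single i 1 := by
      refine ⟨α - Pi.single i 1, ?_⟩
      funext j
      by_cases hj : j = i
      · subst hj
        simp only [Pi.add_apply, Pi.sub_apply, Pi.single_eq_same]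
        omega
      · simp [hj]
    have hβ : ∑ j, β j = k := by
      simp only [Pi.add_apply, Finset.sum_add_distrib, Finset.sum_pi_single', Finset.mem_univ,
        if_true] at hα
      omega
    obtain ⟨C₁, N₁, hC₁, h₁⟩ := ih β hβ ψ
    obtain ⟨C₂, N₂, hC₂, h₂⟩ := ih β hβ (partialTest i ψ)
    obtain ⟨_, _, _, h₃⟩ := exists_gaborSum (Λ₁ := Λ₁) hX hF hχ hχ0 hd ψ
    obtain ⟨_, _, _, h₄⟩ := exists_gaborSum (Λ₁ := Λ₁) hX hF hχ hχ0 hd (partialTest i ψ)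
    -- Multiplying the coefficients by a coordinate of `λ₁` costs one power of the weight.
    refine ⟨C₁ * ‖(2 * Real.pi * Complex.I : ℂ)‖ + C₂, max (N₁ + 1) N₂, by positivity,
      fun c f hf => ?_⟩
    obtain ⟨d₁, -, hd₁⟩ := h₃ (RapidSpace.mulCoord (2 * Real.pi * Complex.I) i c)
    obtain ⟨d₂, -, hd₂⟩ := h₄ c
    obtain ⟨e₁, he₁, hb₁⟩ := h₁ _ _ hd₁
    obtain ⟨e₂, he₂, hb₂⟩ := h₂ _ _ hd₂
    refine ⟨e₁ + e₂, ?_, (norm_add_le _ _).trans ?_⟩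
    · rw [map_add, he₁, he₂, multiDeriv_add_single, Module.End.mul_apply,
        isGaborSum_partialDeriv i hf hd₁ hd₂, map_add]
    · have h5 := RapidSpace.seminorms_mulCoord_le (2 * Real.pi * Complex.I) i N₁ c
      have h6 := RapidSpace.seminorms_mono Λ₁ (le_max_left (N₁ + 1) N₂) c
      have h7 := RapidSpace.seminorms_mono Λ₁ (le_max_right (N₁ + 1) N₂) c
      rw [add_mul, mul_assoc]
      exact add_le_add (hb₁.trans (mul_le_mul_of_nonneg_left (h5.trans (by gcongr)) hC₁))
        (hb₂.trans (by gcongr))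

theorem exists_synthesisOperator [CompleteSpace E] (hX : ShiftBounded X) (hF : FrameBounded X Λ₀)
    (hχ : HasCompactSupport χ) (hχ0 : χ ≠ 0) (hd : DisjointTranslates Λ₀ χ) (ψ : Test n) :
    ∃ D : RapidSpace Λ₁ (DiscreteSpace X Λ₀ χ) →L[ℂ] TestSpace X,
      ∀ c : RapidSpace Λ₁ (DiscreteSpace X Λ₀ χ),
        HasSum (fun l : Λ₀ × Λ₁ => entry c l • ofTest (timeFreqShift (l.1 : V n) l.2 ψ))
          (TestSpace.toDist X (D c)) := by
  obtain ⟨_, _, _, hg⟩ := exists_gaborSum (Λ₁ := Λ₁) hX hF hχ hχ0 hd ψ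
  choose d _ hdg using hg
  have hder := fun α => exists_multiDeriv_gaborSum (Λ₁ := Λ₁) hX hF hχ hχ0 hd _ α rfl ψ
  have hmem : ∀ c, X.incl (d c) ∈ testSubmodule X := fun c =>
    (mem_testSubmodule X _).2 fun α => by
      obtain ⟨_, _, _, h⟩ := hder α
      exact (h c _ (hdg c)).imp fun _ h => h.1
  let D : RapidSpace Λ₁ (DiscreteSpace X Λ₀ χ) →ₗ[ℂ] TestSpace X :=
    LinearMap.codRestrict (testSubmodule X)
      { toFun := fun c => X.incl (d c)
        -- The elements `d c` are arbitrary choices; linearity follows from uniqueness of weak sums.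
        map_add' := fun a b => (hdg (a + b)).unique fun θ => by
          have h := (hdg a θ).add (hdg b θ)
          refine h.congr_fun fun l => ?_
          rw [← add_mul]
          simp only [entry, map_add, Pi.add_apply]
        map_smul' := fun r a => (hdg (r • a)).unique fun θ => by
          have h := (hdg a θ).mul_left r
          refine h.congr_fun fun l => ?_
          rw [← mul_assoc]
          simp only [entry, map_smul, Pi.smul_apply, smul_eq_mul] } hmem
  refine ⟨⟨D, TestSpace.continuous_of_deriv D fun α => ?_⟩, fun c => (hdg c).hasSum hX hχ hχ0 hd⟩
  obtain ⟨C, N, hC, h⟩ := hder α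
  refine (RapidSpace.withSeminorms Λ₁ _).continuous_normedSpace_rng E
    (TestSpace.deriv X α ∘ₗ D) ⟨{N}, ⟨C, hC⟩, fun c => ?_⟩
  rw [Finset.sup_singleton]
  obtain ⟨e, he, heb⟩ := h c _ (hdg c)
  have h1 : TestSpace.deriv X α (D c) = e := X.injective_incl (by
    rw [he, TestSpace.incl_deriv]
    rfl)
  change ‖TestSpace.deriv X α (D c)‖ ≤ C * RapidSpace.seminorms Λ₁ _ N c
  rwa [h1]

end Synthesis

end Gabor

end

theorem proposition5p1 {n : ℕ} {E : Type*} [NormedAddCommGroup E] [NormedSpace ℂ E]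
    [CompleteSpace E] (X : Gabor.DistSpace n E) (hX : Gabor.IsTMIB X ∨ Gabor.IsDTMIB X)
    (Λ₀ Λ₁ : Submodule ℤ (EuclideanSpace ℝ (Fin n)))
    [DiscreteTopology Λ₀] [IsZLattice ℝ Λ₀] [DiscreteTopology Λ₁] [IsZLattice ℝ Λ₁]
    (U : Set (EuclideanSpace ℝ (Fin n))) (hUo : IsOpen U) (hUb : Bornology.IsBounded U)
    (hU0 : (0 : EuclideanSpace ℝ (Fin n)) ∈ U)
    (hUd : Pairwise fun l m : Λ₀ => Disjoint ((fun u => (l : EuclideanSpace ℝ (Fin n)) + u) '' U)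
      ((fun u => (m : EuclideanSpace ℝ (Fin n)) + u) '' U))
    (χ : SchwartzMap (EuclideanSpace ℝ (Fin n)) ℂ) (hχc : HasCompactSupport χ)
    (hχU : tsupport χ ⊆ U) (hχ0 : χ ≠ 0)
    (ψ : SchwartzMap (EuclideanSpace ℝ (Fin n)) ℂ) :
    (∃ C : Gabor.TestSpace X →L[ℂ] Gabor.RapidSpace Λ₁ (Gabor.DiscreteSpace X Λ₀ χ),
      ∀ (f : Gabor.TestSpace X) (l₀ : Λ₀) (l₁ : Λ₁),
        Gabor.DiscreteSpace.coeff X Λ₀ χ (Gabor.RapidSpace.coeff Λ₁ _ (C f) l₁) l₀ =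
          Gabor.stft ψ (Gabor.TestSpace.toDist X f) l₀ l₁) ∧
    (∃ D : Gabor.RapidSpace Λ₁ (Gabor.DiscreteSpace X Λ₀ χ) →L[ℂ] Gabor.TestSpace X,
      ∀ c : Gabor.RapidSpace Λ₁ (Gabor.DiscreteSpace X Λ₀ χ),
        HasSum (fun l : Λ₀ × Λ₁ =>
            Gabor.DiscreteSpace.coeff X Λ₀ χ (Gabor.RapidSpace.coeff Λ₁ _ c l.2) l.1 •
              Gabor.ofTest (Gabor.timeFreqShift (l.1 : EuclideanSpace ℝ (Fin n)) l.2 ψ))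
          (Gabor.TestSpace.toDist X (D c))) := by
  have hS : Gabor.ShiftBounded X := hX.elim (·.shiftBounded) (·.shiftBounded)
  have hF : Gabor.FrameBounded X Λ₀ := hX.elim (·.frameBounded Λ₀) (·.frameBounded Λ₀)
  have hd : Gabor.DisjointTranslates Λ₀ χ := by
    intro l m t hl hm
    by_contra hne
    have h := Set.disjoint_left.1 (hUd hne)
    -- The point `t` would lie in both `l + U` and `m + U`.
    exact @h t ⟨t - l, hχU (subset_tsupport _ hl), by simp⟩
      ⟨t - m, hχU (subset_tsupport _ hm), by simp⟩
  exact ⟨Gabor.exists_analysisOperator hS hF Λ₁ χ ψ,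
    Gabor.exists_synthesisOperator hS hF hχc hχ0 hd ψ⟩
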